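/- Fix $\beta,\gamma>0$ with $\beta+2\gamma<1$ and put $p_{ij}=\min\{\beta N^{2\gamma-1}i^{-\gamma}j^{-\gamma},1\}$ for $i,j\in[N]=\{1,\dots,N\}$. Let $(G_N)_{N\ge1}$ be random simple graphs with vertex set $V(G_N)=[N]$ such that for every $N$ there is a symmetric array $(q_{ij})_{i,j\in[N]}$ of numbers in $(0,\tfrac12)$ for which each edge $\{i,j\}$, $i\ne j$, is present in $G_N$ independently of all others with probability $q_{ij}$, and such that $\sum_{i\neq j}(p_{ij}-q_{ij})^2/p_{ij}\to0$ as $N\to\infty$. Let $\operatorname{d}(v)$ be the degree of $v$ and $\mathscr C(v)$ the connected component of $v$ in $G_N$, and let $K_\gamma=N^{\frac{1-2\gamma}{2-2\gamma}}\log N$. For non-negative random variables $X_N,Y_N$ write $X_N=O_{\mathbb P}^{\log N}(Y_N)$ if there is a constant $K>0$ with $\mathbb P(X_N\le Y_N(\log N)^K)\to1$, and $X_N=O_{\mathbb P}(Y_N)$ if there is a constant $C>0$ with $\mathbb P(X_N\le C\,Y_N)\to1$, as $N\to\infty$; write $X_N=\Theta_{\mathbb P}^{\log N}(Y_N)$,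 respectively $X_N=\Theta_{\mathbb P}(Y_N)$, if the corresponding bound holds both for $(X_N,Y_N)$ and for $(Y_N,X_N)$. Then one can choose, for every $N$, vertices $x=x_N$ and $y=y_N$ of $G_N$, as functions of the graph $G_N$, such that with high probability (i.e. with probability tending to $1$ as $N\to\infty$) $x$ and $y$ are adjacent, $x\le K_\gamma$, $y\le K_\gamma$, and the component $\mathscr C(x)$ is a tree; moreover \[ \operatorname{d}(x)=\Theta_{\mathbb P}^{\log N}\Big(N^{\frac{\gamma}{2-2\gamma}}\Big),\qquad \operatorname{d}(y)=\Theta_{\mathbb P}^{\log N}\Big(N^{\frac{\gamma}{2-2\gamma}}\Big), \] and for every real $\eta\ge1$ \[ \sum_{v\in\mathscr C(x)}\operatorname{d}(v)^\eta=\Theta_{\mathbb P}\Big(N^{\frac{\gamma\eta}{2-2\gamma}}\Big). \] -/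

import Mathlib

open MeasureTheory ProbabilityTheory Filter Topology

namespace DoubleStar

/-- The label in `{1, …, N}` of the vertex `i`: the vertex set `[N]` is modelled by `Fin N`. -/
def label {n : ℕ} (i : Fin n) : ℝ := (i : ℕ) + 1

/-- The Chung-Lu edge probability `min (β N^(2γ-1) / (i^γ j^γ)) 1`. -/
noncomputable def chungLu (β γ : ℝ) (N : ℕ+) (i j : Fin N) : ℝ :=
  min (β * (N : ℝ) ^ (2 * γ - 1) / (label i ^ γ * label j ^ γ)) 1

section Model

variable {Ω : ℕ+ → Type*} [∀ N, MeasurableSpace (Ω N)]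

/-- The sequence `G` of random graphs, where `G N` is defined on the probability space
`(Ω N, P N)` and has vertex set `[N]`, is an inhomogeneous random graph model with parameters
`β, γ`: every edge `{i, j}` of `G N` is present independently of all the others with
probability `q N i j`, where the `q N` are symmetric arrays of numbers in `(0, 1/2)` and
`∑_{i ≠ j} (p_{ij} - q_{ij})² / p_{ij} → 0` for the Chung-Lu probabilities `p_{ij}`. -/
def IsRandomGraphModel (β γ : ℝ) (P : ∀ N, Measure (Ω N))
    (G : ∀ N : ℕ+, Ω N → SimpleGraph (Fin N)) : Prop :=
  ∃ q : ∀ N : ℕ+, Fin N → Fin N → ℝ,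
    (∀ (N : ℕ+) (i j : Fin N), q N i j = q N j i) ∧
    (∀ (N : ℕ+) (i j : Fin N), 0 < q N i j ∧ q N i j < 1 / 2) ∧
    (∀ (N : ℕ+) (i j : Fin N), MeasurableSet {ω | (G N ω).Adj i j}) ∧
    (∀ (N : ℕ+) (i j : Fin N), i ≠ j → P N {ω | (G N ω).Adj i j} = ENNReal.ofReal (q N i j)) ∧
    (∀ N : ℕ+, iIndepSet (fun e : {e : Fin N × Fin N // e.1 < e.2} =>
      {ω | (G N ω).Adj e.1.1 e.1.2}) (P N)) ∧
    Tendsto (fun N : ℕ+ => ∑ i : Fin N, ∑ j : Fin N with i ≠ j,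
      (chungLu β γ N i j - q N i j) ^ 2 / chungLu β γ N i j) atTop (𝓝 0)

/-- The events `A N` hold with high probability. -/
def WHP (P : ∀ N, Measure (Ω N)) (A : ∀ N, Ω N → Prop) : Prop :=
  Tendsto (fun N => P N {ω | A N ω}) atTop (𝓝 1)

/-- `X_N = O_ℙ^{log N}(Y_N)`. -/
def BigOLog (P : ∀ N, Measure (Ω N)) (X Y : ∀ N, Ω N → ℝ) : Prop :=
  ∃ K : ℝ, 0 < K ∧ WHP P fun N ω => X N ω ≤ Y N ω * Real.log (N : ℝ) ^ K

/-- `X_N = Θ_ℙ^{log N}(Y_N)`. -/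
def ThetaLog (P : ∀ N, Measure (Ω N)) (X Y : ∀ N, Ω N → ℝ) : Prop :=
  BigOLog P X Y ∧ BigOLog P Y X

/-- `X_N = O_ℙ(Y_N)`: for some constant `C`, with high probability `X_N ≤ C Y_N`. -/
def BigO (P : ∀ N, Measure (Ω N)) (X Y : ∀ N, Ω N → ℝ) : Prop :=
  ∃ C : ℝ, 0 < C ∧ WHP P fun N ω => X N ω ≤ C * Y N ω

/-- `X_N = Θ_ℙ(Y_N)`. -/
def Theta (P : ∀ N, Measure (Ω N)) (X Y : ∀ N, Ω N → ℝ) : Prop :=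
  BigO P X Y ∧ BigO P Y X

end Model

/-- `K_γ = N^((1-2γ)/(2-2γ)) log N`. -/
noncomputable def bigBound (γ : ℝ) (N : ℕ+) : ℝ :=
  (N : ℝ) ^ ((1 - 2 * γ) / (2 - 2 * γ)) * Real.log (N : ℝ)

open Classical in
/-- The degree of the vertex `v`, as a real number. -/
noncomputable def deg {n : ℕ} (G : SimpleGraph (Fin n)) (v : Fin n) : ℝ := (G.degree v : ℝ)

open Classical in
/-- The sum of `d(v)^η` over the vertices `v` of the connected component of `x`. -/
noncomputable def degreeMoment {n : ℕ} (G : SimpleGraph (Fin n)) (η : ℝ) (x : Fin n) : ℝ :=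
  ∑ v : Fin n with v ∈ (G.connectedComponentMk x).supp, deg G v ^ η

end DoubleStar

/-!
The graph is compared with the Chung-Lu graph, whose edge probabilities
`p u v = β N^(2γ-1) u^(-γ) v^(-γ)` have rank one. By Cauchy-Schwarz and the `χ²`-closeness of the
edge probabilities, an event that is unlikely in the Chung-Lu graph is unlikely in the given one
(`IndepEdges.sq_real_le`, `sq_real_le_of_chungLu`).

Let `k` be of order `N^((1-2γ)/(2-2γ))`, so that `N^(2γ-1) k^(2-2γ)` is of order one, and let `r` be
of order `log N`. The expected number of edges between the labels `(k, 2k]` and `(2k, kr]` grows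
like `r^(1-γ)`; it tends to infinity, so there is such an edge with high probability, and it is at
most of order `r`. A vertex with label `u` has degree of order `(N/u)^γ`. On the first interval this
is `N^(γ/(2-2γ))` up to constants, on the second one up to a power of the logarithm.

For such a pair `x`, `y` the edge `xy` is independent of the rest of the graph. There, explore the
component of `{x, y}` vertex by vertex, removing each explored vertex, and let `w u = u^(-γ)`. Since
`∑ u, p s u * w u ≤ ρ * w s` with `ρ = β / (1 - 2γ) < 1`, the exploration is subcritical, and
exponential functions of the total weight of the active vertices are supermartingales. Thus
`IndepEdges.real_not_explores_le` bounds, by induction on the remaining vertex set, the probability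
that the exploration meets an active vertex again, finds a vertex of a set `L`, or takes more than
`ℓ` steps. With `L` the labels up to `k²` all weights of new vertices are at most `k^(-2γ)`, which
permits a tilting strong enough for the bound `O(k^(-γ))` with `ℓ` of order `(N/k)^γ`
(`exists_real_not_explores_le`). As `r * k^(-γ)` tends to `0`, a first moment bound shows that with
high probability every such edge is a good pair (`exists_real_not_isGoodPair_le`).

An exploration without collision shows that the component of `x` is a tree whose degrees sum to at
most twice its size (`Explores.isTree_component`), and its size is at most a constant times
`N^(γ/(2-2γ))`. For `η ≥ 1` the sum of the `η`-th powers of the degrees is at most the `η`-th power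
of their sum and at least that of the degree of `x`, so both bounds have the required order.
-/

namespace DoubleStar

/-! ### Collision-free exploration of a graph -/

section Exploration

variable {V : Type*} [DecidableEq V]

/-- `Explores G L W S C`: starting from the set `S` of active vertices, an exploration of the
subgraph of `G` induced on `W` ends with the set `C` of explored vertices, without a collision and
without discovering a vertex of `L`. One step removes an active vertex `s` from `W` and makes the
set `n` of its neighbours in `W` active; the step is admissible only if `n` contains no vertex that
is active already and no vertex of `L`. The vertices of `L` may be active at the start. -/
inductive Explores (G : SimpleGraph V) (L : Finset V) : Finset V → Finset V → Finset V → Prop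
  | nil (W : Finset V) : Explores G L W ∅ ∅
  | step {W S C n : Finset V} {s : V} (hs : s ∈ S) (hSW : S ⊆ W)
      (hn : ∀ u, u ∈ n ↔ u ∈ W ∧ G.Adj s u) (hnS : Disjoint n S) (hnL : Disjoint n L)
      (h : Explores G L (W.erase s) (S.erase s ∪ n) C) : Explores G L W S (insert s C)

namespace Explores

variable {G H : SimpleGraph V} {L W S C : Finset V}

lemma subset_right (h : Explores G L W S C) : C ⊆ W := by
  induction h with
  | nil W => simp
  | step hs hSW hn hnS hnL h ih =>
    exact Finset.insert_subset (hSW hs) (ih.trans (Finset.erase_subset _ _))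

lemma subset_left (h : Explores G L W S C) : S ⊆ C := by
  induction h with
  | nil W => simp
  | @step W S C n s hs hSW hn hnS hnL h ih =>
    intro u hu
    by_cases hus : u = s
    · simp [hus]
    · exact Finset.mem_insert_of_mem (ih (by simp [hus, hu]))

/-- The explored set is closed under taking neighbours. -/
lemma closed (h : Explores G L W S C) {u v : V} (hu : u ∈ C) (hv : v ∈ W) (huv : G.Adj u v) :
    v ∈ C := by
  induction h with
  | nil W => simp at hu
  | @step W S C n s hs hSW hn hnS hnL h ih =>
    rcases Finset.mem_insert.1 hu with rfl | hu
    · exact Finset.mem_insert_of_mem (h.subset_left (by simp [hn, hv, huv]))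
    · by_cases hvs : v = s
      · simp [hvs]
      · exact Finset.mem_insert_of_mem (ih hu (by simp [hvs, hv]))

lemma exists_reachable (h : Explores G L W S C) {v : V} (hv : v ∈ C) :
    ∃ s ∈ S, G.Reachable s v := by
  induction h with
  | nil W => simp at hv
  | @step W S C n s hs hSW hn hnS hnL h ih =>
    rcases Finset.mem_insert.1 hv with rfl | hv
    · exact ⟨v, hs, .rfl⟩
    · obtain ⟨u, hu, huv⟩ := ih hv
      rcases Finset.mem_union.1 hu with hu | hu
      · exact ⟨u, Finset.mem_of_mem_erase hu, huv⟩
      · exact ⟨s, hs, (((hn u).1 hu).2.reachable).trans huv⟩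

/-- An exploration of `G` in `W` only looks at the edges within `W`. -/
lemma congr (h : Explores G L W S C) (hGH : ∀ u ∈ W, ∀ v ∈ W, (G.Adj u v ↔ H.Adj u v)) :
    Explores H L W S C := by
  induction h with
  | nil W => exact .nil W
  | @step W S C n s hs hSW hn hnS hnL h ih =>
    refine .step hs hSW (fun u => ?_) hnS hnL
      (ih fun u hu v hv => hGH u (Finset.mem_of_mem_erase hu) v (Finset.mem_of_mem_erase hv))
    rw [hn]
    exact and_congr_right fun hu => hGH s (hSW hs) u hu

open Classical in
/-- In the absence of collisions every vertex of `C \ S` is discovered along exactly one edge, so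
the explored graph has at most `|C| - |S|` edges. -/
lemma sum_degree_le (h : Explores G L W S C) :
    ∑ v ∈ C, (W.filter (G.Adj v)).card + 2 * S.card ≤ 2 * C.card := by
  induction h with
  | nil W => simp
  | @step W S C n s hs hSW hn hnS hnL h ih =>
    have hsC : s ∉ C := fun hc => by simpa using h.subset_right hc
    have hnW : W.filter (G.Adj s) = n := by ext u; simp [hn]
    have hsplit : ∀ v ∈ C, (W.filter (G.Adj v)).card
        = ((W.erase s).filter (G.Adj v)).card + if G.Adj v s then 1 else 0 := by
      intro v _
      conv_lhs => rw [← Finset.insert_erase (hSW hs), Finset.filter_insert]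
      split_ifs with h1
      · rw [Finset.card_insert_of_notMem (by simp)]
      · simp
    have hsum : ∑ v ∈ C, (if G.Adj v s then 1 else 0) ≤ n.card := by
      rw [← Finset.sum_filter, ← Finset.card_eq_sum_ones]
      refine Finset.card_le_card fun v hv => ?_
      rw [Finset.mem_filter] at hv
      exact (hn v).2 ⟨Finset.mem_of_mem_erase (h.subset_right hv.1), hv.2.symm⟩
    have hdisj : Disjoint (S.erase s) n := (hnS.mono_right (Finset.erase_subset _ _)).symm
    have hSn : (S.erase s ∪ n).card + 1 = S.card + n.card := by
      rw [Finset.card_union_of_disjoint hdisj, Finset.card_erase_of_mem hs]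
      have := Finset.card_pos.2 ⟨s, hs⟩
      omega
    rw [Finset.sum_insert hsC, hnW, Finset.card_insert_of_notMem hsC, Finset.sum_congr rfl hsplit,
      Finset.sum_add_distrib]
    omega

end Explores

end Exploration

section Component

open Classical in
/-- A finite component whose degrees sum to at most twice its size minus two is a tree. -/
lemma isTree_of_sum_degree_le {n : ℕ} {G : SimpleGraph (Fin n)} {C : Finset (Fin n)}
    (K : G.ConnectedComponent) (hC : ∀ v, v ∈ K.supp ↔ v ∈ C)
    (hsum : ∑ v ∈ C, G.degree v + 2 ≤ 2 * C.card) : K.toSimpleGraph.IsTree := by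
  have hconn := K.connected_toSimpleGraph
  rw [SimpleGraph.isTree_iff_connected_and_card]
  refine ⟨hconn, le_antisymm ?_ hconn.card_vert_le_card_edgeSet_add_one⟩
  have hcard : Nat.card K = C.card := by
    rw [← Fintype.card_coe C, ← Nat.card_eq_fintype_card]
    exact Nat.card_congr (Equiv.subtypeEquivRight fun v => hC v)
  have hdeg : ∀ v : K, K.toSimpleGraph.degree v = G.degree v := by
    intro v
    rw [← SimpleGraph.card_neighborFinset_eq_degree, ← SimpleGraph.card_neighborFinset_eq_degree]
    refine Finset.card_bij (fun u _ => (u : Fin n)) ?_ (fun _ _ _ _ h => Subtype.ext h) ?_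
    · intro u hu
      simpa using (K.toSimpleGraph_adj v.2 u.2).1 (by simpa using hu)
    · intro u hu
      have hu' : G.Adj v u := by simpa using hu
      have huK : u ∈ K := K.mem_supp_of_adj_mem_supp v.2 hu'
      exact ⟨⟨u, huK⟩, by simpa using (K.toSimpleGraph_adj v.2 huK).2 hu', rfl⟩
  have hs : ∑ v : K, K.toSimpleGraph.degree v = ∑ v ∈ C, G.degree v := by
    rw [Finset.sum_congr rfl fun v _ => hdeg v]
    exact (Finset.sum_subtype C (fun v => (hC v).symm) fun v => G.degree v).symm
  have h2 := K.toSimpleGraph.sum_degrees_eq_twice_card_edges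
  rw [hs] at h2
  rw [hcard, Nat.card_eq_fintype_card, ← SimpleGraph.edgeFinset_card]
  omega

/-- If a collision-free exploration from `{x, y}` of the graph `G` without its edge `xy` ends with
`C`, then the component of `x` in `G` is a tree with vertex set `C`. -/
lemma Explores.isTree_component {n : ℕ} {G : SimpleGraph (Fin n)} {L C : Finset (Fin n)}
    {x y : Fin n} (hxy : G.Adj x y)
    (h : Explores (G.deleteEdges {s(x, y)}) L Finset.univ {x, y} C) :
    (G.connectedComponentMk x).toSimpleGraph.IsTree ∧
      (∀ v, v ∈ (G.connectedComponentMk x).supp ↔ v ∈ C) ∧ ∑ v ∈ C, deg G v ≤ 2 * C.card := by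
  classical
  have hxC : x ∈ C := h.subset_left (by simp)
  have hyC : y ∈ C := h.subset_left (by simp)
  have hclosed : ∀ u v, u ∈ C → G.Adj u v → v ∈ C := by
    intro u v hu huv
    by_cases he : s(u, v) = s(x, y)
    · rcases Sym2.eq_iff.1 he with ⟨_, rfl⟩ | ⟨_, rfl⟩ <;> assumption
    · exact h.closed hu (Finset.mem_univ v) (SimpleGraph.deleteEdges_adj.2 ⟨huv, he⟩)
  have hsupp : ∀ v, v ∈ (G.connectedComponentMk x).supp ↔ v ∈ C := by
    intro v
    rw [SimpleGraph.ConnectedComponent.mem_supp_iff, SimpleGraph.ConnectedComponent.eq]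
    constructor
    · rintro ⟨p⟩
      have : ∀ {u w : Fin n}, G.Walk u w → w ∈ C → u ∈ C := by
        intro u w p
        induction p with
        | nil => exact id
        | cons hadj _ ih => exact fun hw => hclosed _ _ (ih hw) hadj.symm
      exact this p hxC
    · intro hv
      obtain ⟨s, hs, hsv⟩ := h.exists_reachable hv
      have hsv' := (hsv.mono (SimpleGraph.deleteEdges_le _)).symm
      rcases Finset.mem_insert.1 hs with rfl | hs
      · exact hsv'
      · rw [Finset.mem_singleton] at hs
        subst hs
        exact hsv'.trans hxy.symm.reachable
  have hdeg : ∀ v, G.degree v ≤ (Finset.univ.filter ((G.deleteEdges {s(x, y)}).Adj v)).card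
      + ((if v = x then 1 else 0) + if v = y then 1 else 0) := by
    intro v
    rw [← SimpleGraph.card_neighborFinset_eq_degree]
    have hsub : G.neighborFinset v ⊆ Finset.univ.filter ((G.deleteEdges {s(x, y)}).Adj v) ∪
        ((if v = x then {y} else ∅) ∪ if v = y then {x} else ∅) := by
      intro u hu
      have hu' : G.Adj v u := by simpa using hu
      by_cases he : s(v, u) = s(x, y)
      · rcases Sym2.eq_iff.1 he with ⟨rfl, rfl⟩ | ⟨rfl, rfl⟩ <;> simp
      · exact Finset.mem_union_left _ (Finset.mem_filter.2
          ⟨Finset.mem_univ u, SimpleGraph.deleteEdges_adj.2 ⟨hu', he⟩⟩)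
    refine (Finset.card_le_card hsub).trans ((Finset.card_union_le _ _).trans ?_)
    gcongr
    refine (Finset.card_union_le _ _).trans ?_
    gcongr <;> split_ifs <;> simp
  have hsum : ∑ v ∈ C, G.degree v + 2 ≤ 2 * C.card := by
    have h1 : ∑ v ∈ C, (Finset.univ.filter ((G.deleteEdges {s(x, y)}).Adj v)).card
        + 2 * ({x, y} : Finset (Fin n)).card ≤ 2 * C.card := by convert h.sum_degree_le
    have h2 := Finset.sum_le_sum fun v (_ : v ∈ C) => hdeg v
    rw [Finset.sum_add_distrib, Finset.sum_add_distrib, Finset.sum_ite_eq' C x,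
      Finset.sum_ite_eq' C y, if_pos hxC, if_pos hyC] at h2
    rw [Finset.card_pair hxy.ne] at h1
    omega
  refine ⟨isTree_of_sum_degree_le _ hsupp hsum, hsupp, ?_⟩
  have : ∑ v ∈ C, G.degree v ≤ 2 * C.card := by omega
  unfold deg
  exact_mod_cast this

end Component

/-! ### Random graphs with independent edges -/

section Independence

variable {Ω ι : Type*} {mΩ : MeasurableSpace Ω} {μ : Measure Ω}

/-- An event that is determined by the finitely many events `s i`, `i ∈ T`, lies in the σ-algebra
they generate. -/
lemma measurableSet_generateFrom_of_determined [Finite ι] (s : ι → Set Ω) (T : Set ι) {B : Set Ω}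
    (hB : ∀ ω ω', (∀ i ∈ T, (ω ∈ s i ↔ ω' ∈ s i)) → ω ∈ B → ω' ∈ B) :
    MeasurableSet[MeasurableSpace.generateFrom {t | ∃ n ∈ T, s n = t}] B := by
  have hBU : B = ⋃ c ∈ (fun ω => {i | ω ∈ s i}) '' B, {ω' | ∀ i ∈ T, (i ∈ c ↔ ω' ∈ s i)} := by
    ext ω'
    simp only [Set.mem_iUnion, Set.mem_image, exists_prop, Set.mem_ofPred_eq]
    constructor
    · exact fun h => ⟨_, ⟨ω', h, rfl⟩, fun i _ => Iff.rfl⟩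
    · rintro ⟨_, ⟨ω, hω, rfl⟩, h⟩
      exact hB ω ω' h hω
  rw [hBU]
  refine MeasurableSet.biUnion (Set.toFinite _).countable fun c _ => ?_
  have hI : {ω' | ∀ i ∈ T, (i ∈ c ↔ ω' ∈ s i)} = ⋂ i ∈ T, {ω' | i ∈ c ↔ ω' ∈ s i} := by
    ext; simp
  rw [hI]
  refine MeasurableSet.biInter (Set.toFinite _).countable fun i hi => ?_
  have hsi : MeasurableSet[MeasurableSpace.generateFrom {t | ∃ n ∈ T, s n = t}] (s i) :=
    MeasurableSpace.measurableSet_generateFrom ⟨i, hi, rfl⟩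
  by_cases hc : i ∈ c
  · simpa [hc] using hsi
  · have hcompl : {ω' | i ∈ c ↔ ω' ∈ s i} = (s i)ᶜ := by ext; simp [hc]
    rw [hcompl]
    exact hsi.compl

open Classical in
/-- The probability that exactly the events with index in `c` occur, among finitely many
independent events. -/
lemma _root_.ProbabilityTheory.iIndepSet.real_forall_iff [Fintype ι] [IsProbabilityMeasure μ]
    {s : ι → Set Ω} (hs : iIndepSet s μ) (hm : ∀ i, MeasurableSet (s i)) (c : Set ι) :
    μ.real {ω | ∀ i, (ω ∈ s i ↔ i ∈ c)}
      = ∏ i, if i ∈ c then μ.real (s i) else 1 - μ.real (s i) := by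
  have hI : {ω | ∀ i, (ω ∈ s i ↔ i ∈ c)} = ⋂ i, (if i ∈ c then s i else (s i)ᶜ) := by
    ext ω
    simp only [Set.mem_ofPred_eq, Set.mem_iInter]
    refine forall_congr' fun i => ?_
    split_ifs with h <;> simp [h]
  have hsi : ∀ i, MeasurableSet[MeasurableSpace.generateFrom {s i}] (s i) := fun i =>
    MeasurableSpace.measurableSet_generateFrom rfl
  have hprod := iIndep.meas_iInter (s := fun i => if i ∈ c then s i else (s i)ᶜ)
    ((iIndepSet_iff_iIndep s μ).1 hs)
    (fun i => by split_ifs; exacts [hsi i, (hsi i).compl])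
  rw [measureReal_def, hI, hprod, ENNReal.toReal_prod]
  refine Finset.prod_congr rfl fun i _ => ?_
  split_ifs
  · rfl
  · exact probReal_compl_eq_one_sub (hm i)

end Independence

section IndepEdges

variable {Ω V : Type*} [MeasurableSpace Ω] [LinearOrder V]

/-- The edges of the random graph `G` are measurable and independent. An edge is represented by
the increasing pair of its endpoints. -/
structure IndepEdges (μ : Measure Ω) (G : Ω → SimpleGraph V) : Prop where
  measurableSet_adj : ∀ e : {e : V × V // e.1 < e.2}, MeasurableSet {ω | (G ω).Adj e.1.1 e.1.2}
  iIndepSet_adj : iIndepSet (fun e : {e : V × V // e.1 < e.2} =>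
    {ω | (G ω).Adj e.1.1 e.1.2}) μ

/-- The edge between two distinct vertices as an increasing pair. -/
def mkEdge (u v : V) (h : u ≠ v) : {e : V × V // e.1 < e.2} :=
  ⟨(min u v, max u v), min_lt_max.2 h⟩

lemma mkEdge_comm {u v : V} (h : u ≠ v) : mkEdge u v h = mkEdge v u h.symm := by
  simp [mkEdge, min_comm, max_comm]

lemma adj_mkEdge (G : SimpleGraph V) {u v : V} (h : u ≠ v) :
    G.Adj (mkEdge u v h).1.1 (mkEdge u v h).1.2 ↔ G.Adj u v := by
  rcases lt_or_gt_of_ne h with h | h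
  · simp [mkEdge, h.le]
  · simp [mkEdge, h.le, G.adj_comm]

lemma eq_or_eq_of_mkEdge_eq {u v : V} {h : u ≠ v} {e : {e : V × V // e.1 < e.2}}
    (he : mkEdge u v h = e) : (e.1.1 = u ∧ e.1.2 = v) ∨ (e.1.1 = v ∧ e.1.2 = u) := by
  subst he
  rcases lt_or_gt_of_ne h with h | h
  · simp [mkEdge, h.le]
  · simp [mkEdge, h.le]

/-- A graph is determined by its edges, regarded as increasing pairs. -/
lemma eq_of_forall_edge_adj_iff {G H : SimpleGraph V}
    (h : ∀ e : {e : V × V // e.1 < e.2}, G.Adj e.1.1 e.1.2 ↔ H.Adj e.1.1 e.1.2) : G = H := by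
  ext u v
  by_cases huv : u = v
  · simp [huv]
  · rw [← adj_mkEdge G huv, ← adj_mkEdge H huv, h]

/-- The generating function of a random subset of `R` that contains each `u ∈ R` independently
with probability `p u`. -/
lemma sum_powerset_prod_ite {V : Type*} [DecidableEq V] (R : Finset V) (p z : V → ℝ) :
    ∑ n ∈ R.powerset, (∏ u ∈ R, if u ∈ n then p u else 1 - p u) * ∏ u ∈ n, z u
      = ∏ u ∈ R, (1 + p u * (z u - 1)) := by
  have h1 : ∀ u ∈ R, 1 + p u * (z u - 1) = p u * z u + (1 - p u) := fun u _ => by ring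
  rw [Finset.prod_congr rfl h1, Finset.prod_add]
  refine Finset.sum_congr rfl fun n hn => ?_
  have hn := Finset.mem_powerset.1 hn
  have hf : R.filter (· ∈ n) = n := by
    ext u; simpa using fun h => hn h
  have hf' : R.filter (· ∉ n) = R \ n := by ext u; simp
  rw [Finset.prod_ite, hf, hf', Finset.prod_mul_distrib]
  ring

lemma prod_one_add_le_exp_sum {V : Type*} (R : Finset V) {x : V → ℝ} (hx : ∀ u ∈ R, 0 ≤ 1 + x u) :
    ∏ u ∈ R, (1 + x u) ≤ Real.exp (∑ u ∈ R, x u) := by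
  rw [Real.exp_sum]
  exact Finset.prod_le_prod hx fun u _ => by linarith [Real.add_one_le_exp (x u)]

namespace IndepEdges

variable {μ : Measure Ω} {G : Ω → SimpleGraph V} [Fintype V]

lemma measurableSet (hG : IndepEdges μ G) (B : SimpleGraph V → Prop) :
    MeasurableSet {ω | B (G ω)} := by
  refine (MeasurableSpace.generateFrom_le (s := {t | ∃ e ∈ Set.univ, _ = t}) ?_) _
    (measurableSet_generateFrom_of_determined (B := {ω | B (G ω)})
      (fun e : {e : V × V // e.1 < e.2} => {ω | (G ω).Adj e.1.1 e.1.2}) Set.univ ?_)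
  · rintro _ ⟨e, _, rfl⟩
    exact hG.measurableSet_adj e
  · intro ω ω' h hω
    have : G ω = G ω' := eq_of_forall_edge_adj_iff fun e => h e (Set.mem_univ e)
    simpa [← this] using hω

/-- Events that are determined by disjoint sets of edges are independent. -/
lemma real_inter (hG : IndepEdges μ G) (T : Set {e : V × V // e.1 < e.2})
    {B C : SimpleGraph V → Prop}
    (hB : ∀ G H : SimpleGraph V, (∀ e ∈ T, (G.Adj e.1.1 e.1.2 ↔ H.Adj e.1.1 e.1.2)) → B G → B H)
    (hC : ∀ G H : SimpleGraph V, (∀ e ∉ T, (G.Adj e.1.1 e.1.2 ↔ H.Adj e.1.1 e.1.2)) → C G → C H) :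
    μ.real {ω | B (G ω) ∧ C (G ω)} = μ.real {ω | B (G ω)} * μ.real {ω | C (G ω)} := by
  have hind := hG.iIndepSet_adj.indep_generateFrom_of_disjoint hG.measurableSet_adj T Tᶜ
    disjoint_compl_right
  have h := (Indep_iff _ _ _).1 hind {ω | B (G ω)} {ω | C (G ω)}
    (measurableSet_generateFrom_of_determined _ _ fun ω ω' h => hB _ _ h)
    (measurableSet_generateFrom_of_determined _ _ fun ω ω' h => hC _ _ h)
  rw [measureReal_def, measureReal_def, measureReal_def, ← ENNReal.toReal_mul, ← h]
  rfl

/-- Deleting a fixed edge preserves the independence of the edges. -/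
lemma deleteEdges (hG : IndepEdges μ G) (x y : V) :
    IndepEdges μ fun ω => (G ω).deleteEdges {s(x, y)} := by
  have hset : ∀ e : {e : V × V // e.1 < e.2},
      {ω | ((G ω).deleteEdges {s(x, y)}).Adj e.1.1 e.1.2}
        = if s(e.1.1, e.1.2) = s(x, y) then ∅ else {ω | (G ω).Adj e.1.1 e.1.2} := by
    intro e
    split_ifs with h <;> ext ω <;> simp only [Set.mem_ofPred_eq, SimpleGraph.deleteEdges_adj,
      Set.mem_singleton_iff, h, Set.mem_empty_iff_false, not_true_eq_false, not_false_eq_true,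
      and_false, and_true]
  have hmeas : ∀ e : {e : V × V // e.1 < e.2},
      MeasurableSet {ω | ((G ω).deleteEdges {s(x, y)}).Adj e.1.1 e.1.2} :=
    fun e => hG.measurableSet fun H => (H.deleteEdges {s(x, y)}).Adj e.1.1 e.1.2
  refine ⟨hmeas, (iIndepSet_iff_meas_biInter hmeas).2 fun T => ?_⟩
  by_cases h : ∃ e ∈ T, s(e.1.1, e.1.2) = s(x, y)
  · obtain ⟨e, heT, he⟩ := h
    have h0 : {ω | ((G ω).deleteEdges {s(x, y)}).Adj e.1.1 e.1.2} = ∅ := by rw [hset, if_pos he]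
    rw [Finset.prod_eq_zero heT (by rw [h0, measure_empty])]
    refine measure_mono_null (Set.biInter_subset_of_mem heT) ?_
    rw [h0, measure_empty]
  · push Not at h
    have h1 : ∀ e ∈ T, {ω | ((G ω).deleteEdges {s(x, y)}).Adj e.1.1 e.1.2}
        = {ω | (G ω).Adj e.1.1 e.1.2} := fun e he => by rw [hset, if_neg (h e he)]
    rw [Finset.prod_congr rfl fun e he => congrArg μ (h1 e he),
      ← (iIndepSet_iff_meas_biInter hG.measurableSet_adj).1 hG.iIndepSet_adj T]
    congr 1
    exact Set.iInter₂_congr h1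

/-- The presence of the edge `xy` is independent of the graph without that edge. -/
lemma real_adj_inter_deleteEdges (hG : IndepEdges μ G) {x y : V} (hxy : x ≠ y)
    (B : SimpleGraph V → Prop) :
    μ.real {ω | (G ω).Adj x y ∧ B ((G ω).deleteEdges {s(x, y)})}
      = μ.real {ω | (G ω).Adj x y} * μ.real {ω | B ((G ω).deleteEdges {s(x, y)})} := by
  refine hG.real_inter {mkEdge x y hxy} (B := fun H => H.Adj x y)
    (C := fun H => B (H.deleteEdges {s(x, y)})) ?_ ?_
  · intro G H h hG
    rw [← adj_mkEdge H hxy]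
    exact (h _ rfl).1 ((adj_mkEdge G hxy).2 hG)
  · intro G H h hG
    have : G.deleteEdges {s(x, y)} = H.deleteEdges {s(x, y)} := by
      refine eq_of_forall_edge_adj_iff fun e => ?_
      simp only [SimpleGraph.deleteEdges_adj, Set.mem_singleton_iff]
      refine and_congr_left fun he => h e fun hmem => he ?_
      rcases eq_or_eq_of_mkEdge_eq (Set.mem_singleton_iff.1 hmem).symm with h | h
      · rw [h.1, h.2]
      · rw [h.1, h.2, Sym2.eq_swap]
    rwa [← this]

variable [IsProbabilityMeasure μ]

open Classical in
/-- The neighbours of `s` in `R` form the set `n` with the binomial probability, independently of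
the graph with `s` removed. -/
lemma real_star_inter (hG : IndepEdges μ G) {s : V} {R n : Finset V} (hs : s ∉ R)
    {B : SimpleGraph V → Prop}
    (hB : ∀ G H : SimpleGraph V, (∀ u v, u ≠ s → v ≠ s → (G.Adj u v ↔ H.Adj u v)) → B G → B H) :
    μ.real {ω | (∀ u ∈ R, ((G ω).Adj s u ↔ u ∈ n)) ∧ B (G ω)}
      = (∏ u ∈ R, if u ∈ n then μ.real {ω | (G ω).Adj s u} else 1 - μ.real {ω | (G ω).Adj s u})
        * μ.real {ω | B (G ω)} := by
  have hne : ∀ u : R, s ≠ u := fun u h => hs (h ▸ u.2)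
  rw [hG.real_inter {e | e.1.1 = s ∨ e.1.2 = s} (B := fun H => ∀ u ∈ R, (H.Adj s u ↔ u ∈ n))
    (C := B)]
  · congr 1
    have hinj : Function.Injective fun u : R => mkEdge s u (hne u) := by
      intro u v huv
      have h1 := eq_or_eq_of_mkEdge_eq (huv : mkEdge s u (hne u) = mkEdge s v (hne v))
      have h2 := eq_or_eq_of_mkEdge_eq (rfl : mkEdge s v (hne v) = mkEdge s v (hne v))
      have := hne u
      have := hne v
      apply Subtype.ext
      grind
    have hset : (fun u : R => {ω | (G ω).Adj (mkEdge s u (hne u)).1.1 (mkEdge s u (hne u)).1.2})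
        = fun u : R => {ω | (G ω).Adj s u} := by
      ext u ω
      exact adj_mkEdge _ _
    have hi := hG.iIndepSet_adj.precomp hinj
    have h := iIndepSet.real_forall_iff (s := fun u : R => {ω | (G ω).Adj s u})
      (by rw [← hset]; exact hi) (fun u => hG.measurableSet fun H => H.Adj s u) {u | (u : V) ∈ n}
    rw [← Finset.prod_coe_sort R]
    have hev : {ω | ∀ u ∈ R, ((G ω).Adj s u ↔ u ∈ n)}
        = {ω | ∀ u : R, (ω ∈ {ω | (G ω).Adj s u} ↔ u ∈ {u : R | (u : V) ∈ n})} := by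
      ext ω; simp
    rw [hev, h]
    exact Finset.prod_congr rfl fun u _ => by congr 1
  · intro G H h hG u hu
    rw [← hG u hu, ← adj_mkEdge H (hne ⟨u, hu⟩), ← adj_mkEdge G (hne ⟨u, hu⟩)]
    refine (h _ ?_).symm
    rcases eq_or_eq_of_mkEdge_eq (rfl : mkEdge s u (hne ⟨u, hu⟩) = _) with h | h
    · exact Or.inl h.1
    · exact Or.inr h.2
  · intro G H h
    refine hB G H fun u v hu hv => ?_
    by_cases huv : u = v
    · simp [huv]
    · rw [← adj_mkEdge H huv, ← adj_mkEdge G huv]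
      refine h _ ?_
      have := eq_or_eq_of_mkEdge_eq (rfl : mkEdge u v huv = _)
      simp only [Set.mem_ofPred_eq]
      grind

open Classical in
lemma real_star (hG : IndepEdges μ G) {s : V} {R n : Finset V} (hs : s ∉ R) :
    μ.real {ω | ∀ u ∈ R, ((G ω).Adj s u ↔ u ∈ n)}
      = ∏ u ∈ R, if u ∈ n then μ.real {ω | (G ω).Adj s u} else 1 - μ.real {ω | (G ω).Adj s u} := by
  simpa using hG.real_star_inter (n := n) hs (B := fun _ => True) (fun _ _ _ => id)

open Classical in
/-- Chernoff bound for the lower tail of a degree. -/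
lemma real_degree_le (hG : IndepEdges μ G) (s : V) {m : ℝ}
    (hm : m ≤ ∑ u ∈ Finset.univ.erase s, μ.real {ω | (G ω).Adj s u}) :
    μ.real {ω | ((Finset.univ.filter ((G ω).Adj s)).card : ℝ) ≤ m / 4} ≤ Real.exp (-(m / 4)) := by
  set R : Finset V := Finset.univ.erase s with hR
  set p : V → ℝ := fun u => μ.real {ω | (G ω).Adj s u} with hp
  have hsR : s ∉ R := by simp [hR]
  have hp1 : ∀ u, p u ≤ 1 := fun u => measureReal_le_one
  have hp0 : ∀ u, 0 ≤ p u := fun u => measureReal_nonneg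
  have he0 : 0 < Real.exp (-1) := Real.exp_pos _
  have he : Real.exp (-1) ≤ 1 / 2 := by
    rw [Real.exp_neg, one_div]
    exact inv_anti₀ (by norm_num) (by linarith [Real.add_one_le_exp 1])
  have hsub : {ω | ((Finset.univ.filter ((G ω).Adj s)).card : ℝ) ≤ m / 4} ⊆
      ⋃ n ∈ R.powerset.filter (fun n => (n.card : ℝ) ≤ m / 4),
        {ω | ∀ u ∈ R, ((G ω).Adj s u ↔ u ∈ n)} := by
    intro ω hω
    have hsub : Finset.univ.filter ((G ω).Adj s) ⊆ R := fun u hu => by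
      simpa [hR] using ((Finset.mem_filter.1 hu).2).ne'
    simp only [Set.mem_iUnion, Finset.mem_filter, Finset.mem_powerset, exists_prop]
    exact ⟨_, ⟨hsub, hω⟩, fun u _ => by simp⟩
  have hwt : ∀ n : Finset V, 0 ≤ ∏ u ∈ R, if u ∈ n then p u else 1 - p u := fun n =>
    Finset.prod_nonneg fun u _ => by split_ifs; exacts [hp0 u, sub_nonneg.2 (hp1 u)]
  calc μ.real {ω | ((Finset.univ.filter ((G ω).Adj s)).card : ℝ) ≤ m / 4}
      ≤ ∑ n ∈ R.powerset.filter (fun n => (n.card : ℝ) ≤ m / 4),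
          ∏ u ∈ R, if u ∈ n then p u else 1 - p u := by
        refine (measureReal_mono hsub (measure_ne_top _ _)).trans ((measureReal_biUnion_finset_le _ _).trans_eq ?_)
        exact Finset.sum_congr rfl fun n _ => hG.real_star hsR
    _ ≤ ∑ n ∈ R.powerset.filter (fun n => (n.card : ℝ) ≤ m / 4),
          (∏ u ∈ R, if u ∈ n then p u else 1 - p u) *
            (Real.exp (m / 4) * ∏ _u ∈ n, Real.exp (-1)) := by
        refine Finset.sum_le_sum fun n hn => le_mul_of_one_le_right (hwt n) ?_
        rw [Finset.prod_const, ← Real.exp_nat_mul, ← Real.exp_add]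
        refine Real.one_le_exp ?_
        have := (Finset.mem_filter.1 hn).2
        linarith
    _ ≤ ∑ n ∈ R.powerset, (∏ u ∈ R, if u ∈ n then p u else 1 - p u) *
            (Real.exp (m / 4) * ∏ _u ∈ n, Real.exp (-1)) :=
        Finset.sum_le_sum_of_subset_of_nonneg (Finset.filter_subset _ _) fun n _ _ =>
          mul_nonneg (hwt n) (by positivity)
    _ = Real.exp (m / 4) * ∏ u ∈ R, (1 + p u * (Real.exp (-1) - 1)) := by
        rw [← sum_powerset_prod_ite (z := fun _ => Real.exp (-1)), Finset.mul_sum]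
        exact Finset.sum_congr rfl fun n _ => mul_left_comm _ _ _
    _ ≤ Real.exp (m / 4) * Real.exp (∑ u ∈ R, p u * (Real.exp (-1) - 1)) := by
        gcongr
        exact prod_one_add_le_exp_sum R fun u _ => by nlinarith [hp0 u, hp1 u]
    _ ≤ Real.exp (-(m / 4)) := by
        rw [← Real.exp_add, ← Finset.sum_mul, Real.exp_le_exp]
        have : 0 ≤ ∑ u ∈ R, p u := Finset.sum_nonneg fun u _ => hp0 u
        nlinarith

end IndepEdges

end IndepEdges

/-! ### The exploration bound -/

section ExplorationBound

variable {Ω V : Type*} [LinearOrder V] {G : Ω → SimpleGraph V}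

/-- The exploration event fails only if the first step fails, or if the neighbours discovered in
the first step form some admissible set `n` and the exploration of the remaining graph fails. -/
lemma not_explores_subset (L W S : Finset V) {s : V} (hs : s ∈ S) (hSW : S ⊆ W) (ℓ : ℕ) :
    {ω | ¬ ∃ C, Explores (G ω) L W S C ∧ C.card ≤ ℓ + 1} ⊆
      ((⋃ u ∈ S.erase s, {ω | (G ω).Adj s u}) ∪ ⋃ u ∈ L.erase s, {ω | (G ω).Adj s u}) ∪
      ⋃ n ∈ (W.erase s \ (S ∪ L)).powerset,
        {ω | (∀ u ∈ W.erase s \ (S ∪ L), ((G ω).Adj s u ↔ u ∈ n)) ∧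
          ¬ ∃ C, Explores (G ω) L (W.erase s) (S.erase s ∪ n) C ∧ C.card ≤ ℓ} := by
  classical
  intro ω hω
  by_contra hcon
  simp only [Set.mem_union, Set.mem_iUnion, not_or, not_exists, Set.mem_ofPred_eq,
    Finset.mem_powerset, exists_prop, not_and, Finset.mem_erase] at hcon
  obtain ⟨⟨hS, hL⟩, hn⟩ := hcon
  set n := (W.erase s \ (S ∪ L)).filter ((G ω).Adj s) with hn_def
  have hne : ∀ u, (G ω).Adj s u → u ≠ s := fun u hu => hu.ne'
  have h := hn n (Finset.filter_subset _ _) fun u hu => by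
    rw [hn_def, Finset.mem_filter]; exact ⟨fun h => ⟨hu, h⟩, fun h => h.2⟩
  push Not at h
  obtain ⟨C, hC⟩ := h
  refine hω ⟨insert s C, .step hs hSW (fun u => ?_) ?_ ?_ hC.1,
    (Finset.card_insert_le _ _).trans (Nat.add_le_add_right hC.2 1)⟩
  · rw [hn_def, Finset.mem_filter, Finset.mem_sdiff, Finset.mem_erase, Finset.mem_union]
    constructor
    · exact fun h => ⟨h.1.1.2, h.2⟩
    · exact fun h => ⟨⟨⟨hne u h.2, h.1⟩, fun h' => h'.elim (fun h' => hS u ⟨hne u h.2, h'⟩ h.2)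
        fun h' => hL u ⟨hne u h.2, h'⟩ h.2⟩, h.2⟩
  · refine Finset.disjoint_left.2 fun u hu huS => ?_
    simp [hn_def, huS] at hu
  · refine Finset.disjoint_left.2 fun u hu huL => ?_
    simp [hn_def, huL] at hu

/-- The increment inequality behind the supermartingale `exp (t * w S)` of the exploration: the
expected loss in the potential pays for the probability of a collision or of a vertex of `L`. -/
lemma potential_step {a t ρ A wL x σ : ℝ} (ha : 0 ≤ a) (ht : 0 < t) (hρ : 0 ≤ ρ) (hA : 0 ≤ A)
    (hx : 0 ≤ x) (hσ : 0 ≤ σ) (hwL : 0 ≤ wL) (hAa : a / t + a * wL ≤ A * (t * (1 - ρ))) :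
    a * x * σ + a * x * wL + A * (Real.exp (t * σ) * Real.exp (t * ρ * x) - 1)
      ≤ A * (Real.exp (t * (x + σ)) - 1) := by
  have h1 : Real.exp (t * (x + σ))
      = Real.exp (t * σ) * Real.exp (t * ρ * x) * Real.exp (t * (1 - ρ) * x) := by
    rw [← Real.exp_add, ← Real.exp_add]; ring_nf
  have h2 : t * (1 - ρ) * x + 1 ≤ Real.exp (t * (1 - ρ) * x) := Real.add_one_le_exp _
  have h3 : t * σ + 1 ≤ Real.exp (t * σ) := Real.add_one_le_exp _
  have h4 : 1 ≤ Real.exp (t * ρ * x) := Real.one_le_exp (by positivity)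
  set E := Real.exp (t * σ) * Real.exp (t * ρ * x) with hE
  have h5 : t * σ + 1 ≤ E := h3.trans (le_mul_of_one_le_right (Real.exp_pos _).le h4)
  have h0 : 0 ≤ a / t + a * wL := by positivity
  have hE0 : 0 ≤ E := by positivity
  have h6 : a * x * σ + a * x * wL ≤ x * (a / t + a * wL) * (t * σ + 1) := by
    have : x * (a / t + a * wL) * (t * σ + 1)
        = a * x * σ + a * x * wL + x * (a / t) + x * (a * wL) * (t * σ) := by
      field_simp; ring
    rw [this]
    have : 0 ≤ x * (a / t) + x * (a * wL) * (t * σ) := by positivity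
    linarith
  have h7 : x * (a / t + a * wL) * (t * σ + 1) ≤ x * (A * (t * (1 - ρ))) * E := by
    have : 0 ≤ x * (A * (t * (1 - ρ))) := mul_nonneg hx (h0.trans hAa)
    gcongr
  have h8 : A * E * (t * (1 - ρ) * x + 1) ≤ A * E * Real.exp (t * (1 - ρ) * x) := by
    gcongr
  rw [h1]
  nlinarith

variable [MeasurableSpace Ω] [Fintype V] {μ : Measure Ω} [IsProbabilityMeasure μ]
  {w g : V → ℝ} {L : Finset V} {a t ρ A θ : ℝ}

/-- The exploration started from `S` fails to end without a collision, without discovering a vertex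
of `L`, and within `ℓ` steps, with probability at most
`A * (exp (t * ∑ u ∈ S, w u) - 1) + exp (∑ u ∈ S, g u - θ * ℓ)`. The first term accounts for the
collisions and the vertices of `L`, the second for the number of steps; both are supermartingales
along the exploration, because the expected increments are subcritical. -/
theorem IndepEdges.real_not_explores_le (hG : IndepEdges μ G) (hw0 : ∀ u, 0 ≤ w u) (ha : 0 ≤ a)
    (ht : 0 < t) (hρ : 0 ≤ ρ) (hA : 0 ≤ A) (hg0 : ∀ u, 0 ≤ g u)
    (hp : ∀ s u, s ≠ u → μ.real {ω | (G ω).Adj s u} ≤ a * w s * w u)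
    (hw : ∀ s, ∑ u, a * w s * w u * (Real.exp (t * w u) - 1) ≤ t * ρ * w s)
    (hgs : ∀ s, θ + ∑ u ∈ Lᶜ, a * w s * w u * (Real.exp (g u) - 1) ≤ g s)
    (hAa : a / t + a * ∑ u ∈ L, w u ≤ A * (t * (1 - ρ)))
    (W S : Finset V) (hSW : S ⊆ W) (ℓ : ℕ) :
    μ.real {ω | ¬ ∃ C, Explores (G ω) L W S C ∧ C.card ≤ ℓ}
      ≤ A * (Real.exp (t * ∑ u ∈ S, w u) - 1) + Real.exp (∑ u ∈ S, g u - θ * ℓ) := by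
  classical
  induction W using Finset.strongInduction generalizing S ℓ with
  | H W ih =>
  have hΦ : ∀ S : Finset V, 0 ≤ A * (Real.exp (t * ∑ u ∈ S, w u) - 1) := fun S =>
    mul_nonneg hA (sub_nonneg.2 (Real.one_le_exp
      (mul_nonneg ht.le (Finset.sum_nonneg fun u _ => hw0 u))))
  rcases S.eq_empty_or_nonempty with rfl | ⟨s, hs⟩
  · have : {ω | ¬ ∃ C, Explores (G ω) L W ∅ C ∧ C.card ≤ ℓ} = ∅ := by
      ext ω
      simpa using ⟨∅, .nil W, by simp⟩
    rw [this, measureReal_empty]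
    exact add_nonneg (hΦ ∅) (Real.exp_pos _).le
  rcases ℓ with _ | ℓ
  · have : 1 ≤ Real.exp (∑ u ∈ S, g u - θ * (0 : ℕ)) :=
      Real.one_le_exp (by simpa using Finset.sum_nonneg fun u _ => hg0 u)
    linarith [hΦ S, measureReal_le_one (μ := μ)
      (s := {ω | ¬ ∃ C, Explores (G ω) L W S C ∧ C.card ≤ 0})]
  set R := W.erase s \ (S ∪ L) with hR
  set p : V → ℝ := fun u => μ.real {ω | (G ω).Adj s u} with hp_def
  set σ := ∑ u ∈ S.erase s, w u with hσ
  set τ := ∑ u ∈ S.erase s, g u with hτ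
  have hsR : s ∉ R := by simp [hR]
  have hp1 : ∀ u, p u ≤ 1 := fun u => measureReal_le_one
  have hp0 : ∀ u, 0 ≤ p u := fun u => measureReal_nonneg
  have hwt : ∀ n : Finset V, 0 ≤ ∏ u ∈ R, if u ∈ n then p u else 1 - p u := fun n =>
    Finset.prod_nonneg fun u _ => by split_ifs; exacts [hp0 u, sub_nonneg.2 (hp1 u)]
  have hpw : ∀ T : Finset V, s ∉ T → ∑ u ∈ T, p u ≤ a * w s * ∑ u ∈ T, w u := by
    intro T hT
    rw [Finset.mul_sum]
    exact Finset.sum_le_sum fun u hu => hp s u fun h => hT (h ▸ hu)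
  have hhit : ∀ T : Finset V, s ∉ T →
      μ.real (⋃ u ∈ T, {ω | (G ω).Adj s u}) ≤ a * w s * ∑ u ∈ T, w u := fun T hT =>
    (measureReal_biUnion_finset_le _ _).trans (hpw T hT)
  have hLe : ∑ u ∈ L.erase s, w u ≤ ∑ u ∈ L, w u :=
    Finset.sum_le_sum_of_subset_of_nonneg (Finset.erase_subset _ _) fun u _ _ => hw0 u
  have hdisj : ∀ n ∈ R.powerset, Disjoint (S.erase s) n := by
    intro n hn
    refine Finset.disjoint_left.2 fun u hu hun => ?_
    have := Finset.mem_powerset.1 hn hun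
    simp [hR, Finset.mem_of_mem_erase hu] at this
  -- The generating functions of the number of newly discovered vertices, weighted by `w` and `g`.
  have hEw : ∑ n ∈ R.powerset, (∏ u ∈ R, if u ∈ n then p u else 1 - p u) *
      ∏ u ∈ n, Real.exp (t * w u) ≤ Real.exp (t * ρ * w s) := by
    have h1 : ∀ u, 0 ≤ Real.exp (t * w u) - 1 := fun u =>
      sub_nonneg.2 (Real.one_le_exp (mul_nonneg ht.le (hw0 u)))
    rw [sum_powerset_prod_ite]
    refine (prod_one_add_le_exp_sum R fun u _ => by
      have := mul_nonneg (hp0 u) (h1 u); linarith).trans (Real.exp_le_exp.2 ?_)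
    refine (Finset.sum_le_sum fun u hu => mul_le_mul_of_nonneg_right
      (hp s u fun h => hsR (h ▸ hu)) (h1 u)).trans ((Finset.sum_le_sum_of_subset_of_nonneg
        (Finset.subset_univ R) fun u _ _ => ?_).trans (hw s))
    exact mul_nonneg (mul_nonneg (mul_nonneg ha (hw0 s)) (hw0 u)) (h1 u)
  have hEg : ∑ n ∈ R.powerset, (∏ u ∈ R, if u ∈ n then p u else 1 - p u) *
      ∏ u ∈ n, Real.exp (g u) ≤ Real.exp (g s - θ) := by
    have h1 : ∀ u, 0 ≤ Real.exp (g u) - 1 := fun u => sub_nonneg.2 (Real.one_le_exp (hg0 u))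
    have hRL : R ⊆ Lᶜ := fun u hu => by
      simp only [hR, Finset.mem_sdiff, Finset.mem_union, not_or] at hu
      simpa using hu.2.2
    rw [sum_powerset_prod_ite]
    refine (prod_one_add_le_exp_sum R fun u _ => by
      have := mul_nonneg (hp0 u) (h1 u); linarith).trans (Real.exp_le_exp.2 ?_)
    refine (Finset.sum_le_sum fun u hu => mul_le_mul_of_nonneg_right
      (hp s u fun h => hsR (h ▸ hu)) (h1 u)).trans ((Finset.sum_le_sum_of_subset_of_nonneg
        hRL fun u _ _ => ?_).trans (by linarith [hgs s]))
    exact mul_nonneg (mul_nonneg (mul_nonneg ha (hw0 s)) (hw0 u)) (h1 u)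
  have hE1 : ∑ n ∈ R.powerset, (∏ u ∈ R, if u ∈ n then p u else 1 - p u) = 1 := by
    simpa using sum_powerset_prod_ite R p fun _ => 1
  have hrec : ∀ n ∈ R.powerset,
      μ.real {ω | (∀ u ∈ R, ((G ω).Adj s u ↔ u ∈ n)) ∧
          ¬ ∃ C, Explores (G ω) L (W.erase s) (S.erase s ∪ n) C ∧ C.card ≤ ℓ}
      ≤ (∏ u ∈ R, if u ∈ n then p u else 1 - p u) *
        (A * (Real.exp (t * σ) * ∏ u ∈ n, Real.exp (t * w u) - 1)
          + Real.exp (τ - θ * ℓ) * ∏ u ∈ n, Real.exp (g u)) := by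
    intro n hn
    have hnR := Finset.mem_powerset.1 hn
    rw [hG.real_star_inter (B := fun H => ¬ ∃ C, Explores H L (W.erase s) (S.erase s ∪ n) C ∧
      C.card ≤ ℓ) hsR]
    · refine mul_le_mul_of_nonneg_left ?_ (hwt n)
      have h := ih (W.erase s) (Finset.erase_ssubset (hSW hs)) (S.erase s ∪ n)
        (Finset.union_subset (Finset.erase_subset_erase s hSW)
          (hnR.trans Finset.sdiff_subset)) ℓ
      rw [Finset.sum_union (hdisj n hn), Finset.sum_union (hdisj n hn)] at h
      rw [← Real.exp_sum, ← Real.exp_sum, ← Real.exp_add, ← Real.exp_add, ← Finset.mul_sum,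
        ← mul_add]
      refine h.trans_eq ?_
      congr 2
      ring
    · rintro G H h hG ⟨C, hC, hcard⟩
      exact hG ⟨C, hC.congr fun u hu v hv =>
        (h u v (Finset.ne_of_mem_erase hu) (Finset.ne_of_mem_erase hv)).symm, hcard⟩
  have hsumw : ∑ u ∈ S, w u = w s + σ := (Finset.add_sum_erase S w hs).symm
  have hsumg : ∑ u ∈ S, g u = g s + τ := (Finset.add_sum_erase S g hs).symm
  have hσ0 : 0 ≤ σ := Finset.sum_nonneg fun u _ => hw0 u
  have hwL0 : 0 ≤ ∑ u ∈ L, w u := Finset.sum_nonneg fun u _ => hw0 u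
  calc μ.real {ω | ¬ ∃ C, Explores (G ω) L W S C ∧ C.card ≤ ℓ + 1}
      ≤ (a * w s * σ + a * w s * ∑ u ∈ L, w u) + ∑ n ∈ R.powerset,
          (∏ u ∈ R, if u ∈ n then p u else 1 - p u) *
          (A * (Real.exp (t * σ) * ∏ u ∈ n, Real.exp (t * w u) - 1)
            + Real.exp (τ - θ * ℓ) * ∏ u ∈ n, Real.exp (g u)) := by
        refine (measureReal_mono (not_explores_subset L W S hs hSW ℓ) (measure_ne_top _ _)).trans
          ((measureReal_union_le _ _).trans (add_le_add ((measureReal_union_le _ _).trans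
            (add_le_add (hhit _ (Finset.notMem_erase s S)) ?_)) ?_))
        · exact (hhit _ (Finset.notMem_erase s L)).trans
            (mul_le_mul_of_nonneg_left hLe (mul_nonneg ha (hw0 s)))
        · exact (measureReal_biUnion_finset_le _ _).trans (Finset.sum_le_sum hrec)
    _ = (a * w s * σ + a * w s * ∑ u ∈ L, w u) +
          (A * (Real.exp (t * σ) * (∑ n ∈ R.powerset,
            (∏ u ∈ R, if u ∈ n then p u else 1 - p u) * ∏ u ∈ n, Real.exp (t * w u)) -
              ∑ n ∈ R.powerset, (∏ u ∈ R, if u ∈ n then p u else 1 - p u))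
            + Real.exp (τ - θ * ℓ) * ∑ n ∈ R.powerset,
            (∏ u ∈ R, if u ∈ n then p u else 1 - p u) * ∏ u ∈ n, Real.exp (g u)) := by
        congr 1
        rw [Finset.mul_sum _ _ (Real.exp (t * σ)), Finset.mul_sum _ _ (Real.exp (τ - θ * ℓ)),
          ← Finset.sum_sub_distrib, Finset.mul_sum _ _ A, ← Finset.sum_add_distrib]
        exact Finset.sum_congr rfl fun n _ => by ring
    _ ≤ (a * w s * σ + a * w s * ∑ u ∈ L, w u) +
          (A * (Real.exp (t * σ) * Real.exp (t * ρ * w s) - 1)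
            + Real.exp (τ - θ * ℓ) * Real.exp (g s - θ)) := by
        rw [hE1]
        gcongr
    _ ≤ A * (Real.exp (t * ∑ u ∈ S, w u) - 1) + Real.exp (∑ u ∈ S, g u - θ * (ℓ + 1 : ℕ)) := by
        have h1 := potential_step ha ht hρ hA (hw0 s) hσ0 hwL0 hAa
        have h2 : Real.exp (τ - θ * ℓ) * Real.exp (g s - θ)
            = Real.exp (∑ u ∈ S, g u - θ * (ℓ + 1 : ℕ)) := by
          rw [← Real.exp_add, hsumg]
          push_cast
          ring_nf
        rw [hsumw, ← h2]
        linarith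

end ExplorationBound

/-! ### Comparison of two random graphs -/

section Comparison

variable {V : Type*} [LinearOrder V] [Fintype V]

section

variable {Ω Ω' : Type*} [MeasurableSpace Ω] [MeasurableSpace Ω'] {μ : Measure Ω} {ν : Measure Ω'}
  [IsProbabilityMeasure μ] [IsProbabilityMeasure ν]
  {G : Ω → SimpleGraph V} {G' : Ω' → SimpleGraph V}

open Classical in
lemma IndepEdges.real_eq (hG : IndepEdges μ G) (H : SimpleGraph V) :
    μ.real {ω | G ω = H} = ∏ e : {e : V × V // e.1 < e.2}, if H.Adj e.1.1 e.1.2 then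
      μ.real {ω | (G ω).Adj e.1.1 e.1.2} else 1 - μ.real {ω | (G ω).Adj e.1.1 e.1.2} := by
  have h := hG.iIndepSet_adj.real_forall_iff hG.measurableSet_adj {e | H.Adj e.1.1 e.1.2}
  have hset : {ω | G ω = H} = {ω | ∀ e : {e : V × V // e.1 < e.2},
      ω ∈ {ω | (G ω).Adj e.1.1 e.1.2} ↔ e ∈ {e | H.Adj e.1.1 e.1.2}} := by
    ext ω
    exact ⟨fun h e => by rw [Set.mem_ofPred_eq] at h; simp [h], fun h => eq_of_forall_edge_adj_iff h⟩
  rw [hset, h]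
  exact Finset.prod_congr rfl fun e _ => by congr 1

open Classical in
lemma IndepEdges.real_eq_sum (hG : IndepEdges μ G) (B : SimpleGraph V → Prop) :
    μ.real {ω | B (G ω)}
      = ∑ H ∈ (Set.toFinite {H : SimpleGraph V | B H}).toFinset, μ.real {ω | G ω = H} := by
  rw [← measureReal_biUnion_finset]
  · congr 1
    ext ω
    simp
  · intro H _ H' _ hne
    refine Set.disjoint_left.2 fun ω h h' => hne ?_
    exact (show G ω = H from h).symm.trans h'
  · exact fun H _ => hG.measurableSet fun K => K = H

/-- A product over the edges, summed over a set of graphs, is at most the product of the sums over the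
two states of each edge. -/
lemma sum_prod_edges_le (f₁ f₂ : {e : V × V // e.1 < e.2} → ℝ) (h₁ : ∀ e, 0 ≤ f₁ e)
    (h₂ : ∀ e, 0 ≤ f₂ e) (T : Finset (SimpleGraph V)) [∀ H : SimpleGraph V, DecidableRel H.Adj] :
    ∑ H ∈ T, ∏ e : {e : V × V // e.1 < e.2}, (if H.Adj e.1.1 e.1.2 then f₁ e else f₂ e)
      ≤ ∏ e, (f₁ e + f₂ e) := by
  classical
  set φ : SimpleGraph V → Finset {e : V × V // e.1 < e.2} := fun H =>
    Finset.univ.filter fun e => H.Adj e.1.1 e.1.2 with hφ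
  have hinj : Function.Injective φ := fun H H' h => eq_of_forall_edge_adj_iff fun e => by
    have := Finset.ext_iff.1 h e
    simpa [hφ] using this
  have hval : ∀ H : SimpleGraph V, ∏ e : {e : V × V // e.1 < e.2},
      (if H.Adj e.1.1 e.1.2 then f₁ e else f₂ e)
        = (∏ e ∈ φ H, f₁ e) * ∏ e ∈ Finset.univ \ φ H, f₂ e := by
    intro H
    rw [Finset.prod_ite]
    congr 2
    ext e
    simp [hφ]
  rw [Finset.prod_add, Finset.sum_congr rfl fun H _ => hval H,
    ← Finset.sum_image (f := fun c => (∏ e ∈ c, f₁ e) * ∏ e ∈ Finset.univ \ c, f₂ e)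
      (fun H _ H' _ h => hinj h)]
  exact Finset.sum_le_sum_of_subset_of_nonneg (fun c _ => by simp) fun c _ _ =>
    mul_nonneg (Finset.prod_nonneg fun e _ => h₁ e) (Finset.prod_nonneg fun e _ => h₂ e)

/-- Probabilities in one random graph are controlled by those in another one whose edge
probabilities are close in the `χ²` sense: by Cauchy-Schwarz the likelihood ratio has second moment
`∏ (1 + (q - p)² / (p (1 - p)))`. -/
theorem IndepEdges.sq_real_le (hG : IndepEdges μ G) (hG' : IndepEdges ν G')
    (hp : ∀ e : {e : V × V // e.1 < e.2}, 0 < ν.real {ω | (G' ω).Adj e.1.1 e.1.2} ∧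
      ν.real {ω | (G' ω).Adj e.1.1 e.1.2} < 1) (B : SimpleGraph V → Prop) :
    μ.real {ω | B (G ω)} ^ 2
      ≤ Real.exp (∑ e : {e : V × V // e.1 < e.2},
          (μ.real {ω | (G ω).Adj e.1.1 e.1.2} - ν.real {ω | (G' ω).Adj e.1.1 e.1.2}) ^ 2 /
            (ν.real {ω | (G' ω).Adj e.1.1 e.1.2} * (1 - ν.real {ω | (G' ω).Adj e.1.1 e.1.2})))
        * ν.real {ω | B (G' ω)} := by
  classical
  set q : {e : V × V // e.1 < e.2} → ℝ := fun e => μ.real {ω | (G ω).Adj e.1.1 e.1.2} with hq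
  set p : {e : V × V // e.1 < e.2} → ℝ := fun e => ν.real {ω | (G' ω).Adj e.1.1 e.1.2} with hp'
  have hp0 : ∀ e, 0 < p e := fun e => (hp e).1
  have hp1 : ∀ e, 0 < 1 - p e := fun e => sub_pos.2 (hp e).2
  have hpos : ∀ H : SimpleGraph V, 0 < ν.real {ω | G' ω = H} := by
    intro H
    rw [hG'.real_eq]
    exact Finset.prod_pos fun e _ => by split_ifs; exacts [hp0 e, hp1 e]
  set T := (Set.toFinite {H : SimpleGraph V | B H}).toFinset
  have hratio : ∀ H : SimpleGraph V, μ.real {ω | G ω = H} ^ 2 / ν.real {ω | G' ω = H}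
      = ∏ e : {e : V × V // e.1 < e.2},
        (if H.Adj e.1.1 e.1.2 then q e ^ 2 / p e else (1 - q e) ^ 2 / (1 - p e)) := by
    intro H
    rw [hG.real_eq, hG'.real_eq, ← Finset.prod_pow, ← Finset.prod_div_distrib]
    exact Finset.prod_congr rfl fun e _ => by split_ifs <;> rfl
  have hfac : ∀ e, q e ^ 2 / p e + (1 - q e) ^ 2 / (1 - p e)
      = 1 + (q e - p e) ^ 2 / (p e * (1 - p e)) := by
    intro e
    have := (hp0 e).ne'
    have := (hp1 e).ne'
    field_simp
    ring
  rw [hG.real_eq_sum, hG'.real_eq_sum]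
  calc (∑ H ∈ T, μ.real {ω | G ω = H}) ^ 2
      ≤ (∑ H ∈ T, μ.real {ω | G ω = H} ^ 2 / ν.real {ω | G' ω = H}) *
          ∑ H ∈ T, ν.real {ω | G' ω = H} := by
        refine Finset.sum_sq_le_sum_mul_sum_of_sq_le_mul T
          (fun H _ => div_nonneg (sq_nonneg _) (hpos H).le) (fun H _ => (hpos H).le) fun H _ => ?_
        rw [div_mul_cancel₀ _ (hpos H).ne']
    _ ≤ _ := by
        gcongr
        rw [Finset.sum_congr rfl fun H _ => hratio H]
        refine (sum_prod_edges_le _ _ (fun e => div_nonneg (sq_nonneg _) (hp0 e).le)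
          (fun e => div_nonneg (sq_nonneg _) (hp1 e).le) T).trans ?_
        rw [Finset.prod_congr rfl fun e _ => hfac e]
        refine prod_one_add_le_exp_sum _ fun e _ => ?_
        have := div_nonneg (sq_nonneg (q e - p e)) (mul_pos (hp0 e) (hp1 e)).le
        linarith

end

/-- A random graph with independent edges and prescribed edge probabilities exists. -/
theorem exists_indepEdges (p : V → V → ℝ) (hsymm : ∀ u v, p u v = p v u)
    (h0 : ∀ u v, 0 ≤ p u v) (h1 : ∀ u v, p u v ≤ 1) :
    ∃ (ν : Measure ({e : V × V // e.1 < e.2} → Bool))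
      (G : ({e : V × V // e.1 < e.2} → Bool) → SimpleGraph V),
      IsProbabilityMeasure ν ∧ IndepEdges ν G ∧
        ∀ u v, u ≠ v → ν.real {ω | (G ω).Adj u v} = p u v := by
  set b : {e : V × V // e.1 < e.2} → Measure Bool := fun e =>
    bernoulliMeasure true false ⟨p e.1.1 e.1.2, h0 _ _, h1 _ _⟩ with hb
  have : ∀ e, IsProbabilityMeasure (b e) := fun e => by rw [hb]; infer_instance
  set G : ({e : V × V // e.1 < e.2} → Bool) → SimpleGraph V := fun ω =>
    { Adj := fun u v => ∃ h : u ≠ v, ω (mkEdge u v h) = true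
      symm := ⟨fun u v ⟨h, hω⟩ => ⟨h.symm, by rwa [← mkEdge_comm h]⟩⟩
      loopless := ⟨fun u ⟨h, _⟩ => h rfl⟩ } with hGdef
  have hadj : ∀ e : {e : V × V // e.1 < e.2},
      {ω | (G ω).Adj e.1.1 e.1.2} = (fun ω => ω e) ⁻¹' {true} := by
    intro e
    have he : mkEdge e.1.1 e.1.2 e.2.ne = e := by
      apply Subtype.ext
      simp [mkEdge, e.2.le]
    ext ω
    simp only [hGdef, Set.mem_ofPred_eq, Set.mem_preimage, Set.mem_singleton_iff]
    constructor
    · rintro ⟨h, hω⟩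
      rwa [he] at hω
    · exact fun h => ⟨e.2.ne, by rwa [he]⟩
  have hmeas : ∀ e : {e : V × V // e.1 < e.2},
      MeasurableSet {ω | (G ω).Adj e.1.1 e.1.2} := fun e => by
    rw [hadj]
    exact measurable_pi_apply e (measurableSet_singleton true)
  have hind : iIndepFun (fun (e : {e : V × V // e.1 < e.2}) (ω : _ → Bool) => ω e)
      (Measure.pi b) := iIndepFun_pi (X := fun _ => id) fun _ => aemeasurable_id
  refine ⟨Measure.pi b, G, inferInstance, ⟨hmeas, ?_⟩, fun u v huv => ?_⟩
  · refine (iIndepSet_iff_meas_biInter hmeas).2 fun T => ?_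
    simp_rw [hadj]
    exact hind.measure_inter_preimage_eq_mul T fun e _ => measurableSet_singleton true
  · have hset : {ω | (G ω).Adj u v} = (fun ω => ω (mkEdge u v huv)) ⁻¹' {true} := by
      rw [← hadj]
      ext ω
      exact (adj_mkEdge (G ω) huv).symm
    have hpe : p (mkEdge u v huv).1.1 (mkEdge u v huv).1.2 = p u v := by
      rcases eq_or_eq_of_mkEdge_eq (rfl : mkEdge u v huv = _) with h | h
      · rw [h.1, h.2]
      · rw [h.1, h.2, hsymm]
    rw [measureReal_def, hset, (measurePreserving_eval b (mkEdge u v huv)).measure_preimage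
      (measurableSet_singleton true).nullMeasurableSet, ← measureReal_def, hb,
      bernoulliMeasure_real_apply_of_mem_of_notMem _ (measurableSet_singleton true) rfl (by simp)]
    exact hpe

end Comparison

/-! ### Explorations in the Chung-Lu graph -/

section Sums

lemma sum_range_rpow_neg_le {s : ℝ} (hs0 : 0 ≤ s) (hs1 : s < 1) (n : ℕ) :
    ∑ j ∈ Finset.range n, ((j : ℝ) + 1) ^ (-s) ≤ (n : ℝ) ^ (1 - s) / (1 - s) := by
  have h1s : 0 < 1 - s := by linarith
  induction n with
  | zero => simp [Real.zero_rpow h1s.ne']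
  | succ n ih =>
    rw [Finset.sum_range_succ]
    push_cast
    have hn : (0 : ℝ) < n + 1 := by positivity
    -- Bernoulli's inequality for `(n / (n + 1)) ^ (1 - s)`.
    have hb : ((n : ℝ) / (n + 1)) ^ (1 - s) ≤ 1 - (1 - s) / (n + 1) := by
      have h := rpow_one_add_le_one_add_mul_self (s := -1 / ((n : ℝ) + 1))
        (by rw [le_div_iff₀ hn]; linarith [n.cast_nonneg (α := ℝ)]) h1s.le (by linarith : 1 - s ≤ 1)
      have e1 : 1 + -1 / ((n : ℝ) + 1) = n / (n + 1) := by field_simp; ring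
      rw [e1] at h
      refine h.trans_eq ?_
      ring
    have hsplit : (n : ℝ) ^ (1 - s) = (n / (n + 1)) ^ (1 - s) * (n + 1 : ℝ) ^ (1 - s) := by
      rw [← Real.mul_rpow (by positivity) hn.le, div_mul_cancel₀ _ hn.ne']
    have hpow : (n + 1 : ℝ) ^ (-s) = (n + 1 : ℝ) ^ (1 - s) / (n + 1) := by
      rw [show -s = (1 - s) - 1 by ring, Real.rpow_sub_one hn.ne']
    have hX : 0 < (n + 1 : ℝ) ^ (1 - s) := by positivity
    calc _ ≤ (n : ℝ) ^ (1 - s) / (1 - s) + (n + 1 : ℝ) ^ (-s) := by gcongr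
      _ ≤ (1 - (1 - s) / (n + 1)) * (n + 1 : ℝ) ^ (1 - s) / (1 - s)
            + (n + 1 : ℝ) ^ (1 - s) / (n + 1) := by
          rw [hsplit, hpow]; gcongr
      _ = (n + 1 : ℝ) ^ (1 - s) / (1 - s) := by field_simp; ring

lemma label_pos {n : ℕ} (i : Fin n) : 0 < label i := by unfold label; positivity

lemma one_le_label {n : ℕ} (i : Fin n) : 1 ≤ label i := by unfold label; simp

lemma label_le {n : ℕ} (i : Fin n) : label i ≤ n := by
  unfold label
  exact_mod_cast i.2

lemma sum_label_rpow_neg_le {s : ℝ} (hs0 : 0 ≤ s) (hs1 : s < 1) (n : ℕ) :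
    ∑ i : Fin n, label i ^ (-s) ≤ (n : ℝ) ^ (1 - s) / (1 - s) := by
  refine le_trans (le_of_eq ?_) (sum_range_rpow_neg_le hs0 hs1 n)
  exact Fin.sum_univ_eq_sum_range (fun j => ((j : ℝ) + 1) ^ (-s)) n

lemma sum_label_le_rpow_neg_le {s : ℝ} (hs0 : 0 ≤ s) (hs1 : s < 1) (n K : ℕ) :
    ∑ i : Fin n with label i ≤ K, label i ^ (-s) ≤ (K : ℝ) ^ (1 - s) / (1 - s) := by
  refine le_trans ?_ (sum_range_rpow_neg_le hs0 hs1 K)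
  have hinj : Set.InjOn (fun i : Fin n => (i : ℕ))
      (Finset.univ.filter fun i : Fin n => label i ≤ K) := fun i _ j _ h => Fin.ext h
  have h1 : ∑ i : Fin n with label i ≤ K, label i ^ (-s)
      = ∑ j ∈ (Finset.univ.filter fun i : Fin n => label i ≤ K).image (fun i : Fin n => (i : ℕ)),
        ((j : ℝ) + 1) ^ (-s) := 
    (Finset.sum_image (f := fun j : ℕ => ((j : ℝ) + 1) ^ (-s)) hinj).symm
  rw [h1]
  refine Finset.sum_le_sum_of_subset_of_nonneg ?_ fun j _ _ => by positivity
  intro j hj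
  obtain ⟨i, hi, rfl⟩ := Finset.mem_image.1 hj
  have := (Finset.mem_filter.1 hi).2
  unfold label at this
  rw [Finset.mem_range]
  exact_mod_cast this

/-- Near `0` the function `exp z - 1` is almost linear. -/
lemma exists_exp_sub_one_le {κ : ℝ} (hκ : 1 < κ) :
    ∃ t : ℝ, 0 < t ∧ ∀ z, 0 ≤ z → z ≤ t → Real.exp z - 1 ≤ κ * z := by
  refine ⟨min 1 (κ - 1), lt_min one_pos (by linarith), fun z hz hzt => ?_⟩
  have h1 : z ≤ 1 := hzt.trans (min_le_left _ _)
  have h2 : z ≤ κ - 1 := hzt.trans (min_le_right _ _)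
  have h3 := (abs_le.1 (Real.abs_exp_sub_one_sub_id_le (abs_le.2 ⟨by linarith, h1⟩))).2
  nlinarith

lemma exp_sub_one_le_mul_exp (z : ℝ) : Real.exp z - 1 ≤ z * Real.exp z := by
  have h1 := Real.add_one_le_exp (-z)
  have h2 : Real.exp (-z) * Real.exp z = 1 := by rw [← Real.exp_add]; simp
  nlinarith [Real.exp_pos z]

lemma exp_neg_le_inv {z : ℝ} (hz : 0 < z) : Real.exp (-z) ≤ z⁻¹ := by
  rw [Real.exp_neg]
  exact inv_anti₀ hz (by linarith [Real.add_one_le_exp z])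

end Sums

section ChungLu

variable {β γ : ℝ}

/-- In a subcritical graph with edge probabilities at most `β N^(2γ-1) (uv)^(-γ)`, explore from two
vertices with labels of order `k`, where `k^(2-2γ)` is at most of order `N^(1-2γ)`. With failure
probability `O(k^(-γ))` there is no collision, no further vertex with label at most `k²` is found,
and at most `O((N/k)^γ)` vertices are discovered. -/
theorem exists_real_not_explores_le (hβ : 0 < β) (hγ : 0 < γ) (hsub : β + 2 * γ < 1) :
    ∃ C C₀ : ℝ, 0 < C ∧ 0 < C₀ ∧ ∀ (N k ℓ : ℕ), 1 ≤ N → 1 ≤ k → k ^ 2 ≤ N →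
      (N : ℝ) ^ (2 * γ - 1) * (k : ℝ) ^ (2 - 2 * γ) ≤ 4 → C * ((N : ℝ) / k) ^ γ ≤ ℓ →
      ∀ {Ω : Type} [MeasurableSpace Ω] (μ : Measure Ω) [IsProbabilityMeasure μ]
        (G : Ω → SimpleGraph (Fin N)), IndepEdges μ G →
        (∀ s u, s ≠ u → μ.real {ω | (G ω).Adj s u}
          ≤ β * (N : ℝ) ^ (2 * γ - 1) * label s ^ (-γ) * label u ^ (-γ)) →
        ∀ x y : Fin N, x ≠ y → (k : ℝ) ≤ label x → (k : ℝ) ≤ label y →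
          μ.real {ω | ¬ ∃ D, Explores (G ω) (Finset.univ.filter fun u => label u ≤ (k ^ 2 : ℕ))
            Finset.univ {x, y} D ∧ D.card ≤ ℓ} ≤ C₀ * (k : ℝ) ^ (-γ) := by
  have h2γ : 0 < 1 - 2 * γ := by linarith
  have h1γ : 0 < 1 - γ := by linarith
  -- The mean offspring number `ρ` is less than `1`; `ρ'` leaves room for the exponential tilting.
  set ρ := β / (1 - 2 * γ) with hρ
  have hρ0 : 0 < ρ := by positivity
  have hρ1 : ρ < 1 := by rw [hρ, div_lt_one h2γ]; linarith
  set ρ' := (1 + ρ) / 2 with hρ'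
  have hρ'1 : 0 < 1 - ρ' := by rw [hρ']; linarith
  have hρ'0 : 0 < ρ' := by positivity
  set κ := ρ' / ρ with hκ
  have hκ1 : 1 < κ := by rw [hκ, one_lt_div hρ0]; linarith
  have hκρ : κ * ρ = ρ' := div_mul_cancel₀ _ hρ0.ne'
  have hκ0 : 0 < κ := by linarith
  obtain ⟨t, ht, hexp⟩ := exists_exp_sub_one_le hκ1
  set c₁ := β / (1 - γ) with hc₁
  have hc₁0 : 0 < c₁ := by positivity
  set c := t / 2 * min 1 ((1 - ρ') / (κ * c₁)) with hc
  have hc0 : 0 < c := by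
    have : 0 < min 1 ((1 - ρ') / (κ * c₁)) := lt_min one_pos (by positivity)
    positivity
  have hct : c ≤ t / 2 := by
    rw [hc]; exact mul_le_of_le_one_right (by positivity) (min_le_left _ _)
  have hcκ : κ * c * c₁ ≤ (1 - ρ') * (t / 2) := by
    have h1 : c ≤ t / 2 * ((1 - ρ') / (κ * c₁)) := by
      rw [hc]; exact mul_le_mul_of_nonneg_left (min_le_right _ _) (by positivity)
    calc κ * c * c₁ ≤ κ * (t / 2 * ((1 - ρ') / (κ * c₁))) * c₁ := by gcongr
      _ = (1 - ρ') * (t / 2) := by field_simp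
  set A := (β / t + 4 * β / (1 - γ)) / (t * (1 - ρ')) with hA
  have hA0 : 0 < A := by positivity
  refine ⟨(t + 1) / c, A * (2 * t * Real.exp (2 * t)) + Real.exp t, by positivity, by positivity,
    ?_⟩
  intro N k ℓ hN hk hkN hkc hℓ Ω _ μ _ G hG hp x y hxy hx hy
  have hNpos : (0 : ℝ) < N := by exact_mod_cast hN
  have hkpos : (0 : ℝ) < k := by exact_mod_cast hk
  have hk1 : (1 : ℝ) ≤ k := by exact_mod_cast hk
  set a := β * (N : ℝ) ^ (2 * γ - 1) with ha
  have ha0 : 0 < a := by positivity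
  have haβ : a ≤ β := mul_le_of_le_one_right hβ.le
    (Real.rpow_le_one_of_one_le_of_nonpos (by exact_mod_cast hN) (by linarith))
  set w : Fin N → ℝ := fun u => label u ^ (-γ) with hw
  have hw0 : ∀ u, 0 < w u := fun u => Real.rpow_pos_of_pos (label_pos u) _
  have hw1 : ∀ u, w u ≤ 1 := fun u =>
    Real.rpow_le_one_of_one_le_of_nonpos (one_le_label u) (by linarith)
  set L : Finset (Fin N) := Finset.univ.filter fun u => label u ≤ (k ^ 2 : ℕ) with hL
  -- First and second moments of the weights.
  have hsum1 : a * ∑ u, w u ≤ c₁ * (N : ℝ) ^ γ := by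
    calc a * ∑ u, w u ≤ a * ((N : ℝ) ^ (1 - γ) / (1 - γ)) := by
          gcongr; exact sum_label_rpow_neg_le hγ.le (by linarith) N
      _ = c₁ * ((N : ℝ) ^ (2 * γ - 1) * (N : ℝ) ^ (1 - γ)) := by rw [ha, hc₁]; ring
      _ = c₁ * (N : ℝ) ^ γ := by rw [← Real.rpow_add hNpos]; congr 2; ring
  have hsum2 : a * ∑ u, w u ^ 2 ≤ ρ := by
    have hsq : ∀ u : Fin N, w u ^ 2 = label u ^ (-(2 * γ)) := fun u => by
      rw [hw, ← Real.rpow_natCast, ← Real.rpow_mul (label_pos u).le]; congr 1; push_cast; ring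
    calc a * ∑ u, w u ^ 2 ≤ a * ((N : ℝ) ^ (1 - 2 * γ) / (1 - 2 * γ)) := by
          rw [Finset.sum_congr rfl fun u _ => hsq u]
          gcongr; exact sum_label_rpow_neg_le (by positivity) (by linarith) N
      _ = ρ * ((N : ℝ) ^ (2 * γ - 1) * (N : ℝ) ^ (1 - 2 * γ)) := by rw [ha, hρ]; ring
      _ = ρ := by rw [← Real.rpow_add hNpos]; simp
  have hsumL : a * ∑ u ∈ L, w u ≤ 4 * β / (1 - γ) := by
    have hkk : ((k ^ 2 : ℕ) : ℝ) ^ (1 - γ) = (k : ℝ) ^ (2 - 2 * γ) := by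
      push_cast
      rw [← Real.rpow_natCast, ← Real.rpow_mul hkpos.le]; congr 1; push_cast; ring
    calc a * ∑ u ∈ L, w u ≤ a * (((k ^ 2 : ℕ) : ℝ) ^ (1 - γ) / (1 - γ)) := by
          gcongr; exact sum_label_le_rpow_neg_le hγ.le (by linarith) N (k ^ 2)
      _ = β * ((N : ℝ) ^ (2 * γ - 1) * (k : ℝ) ^ (2 - 2 * γ)) / (1 - γ) := by
          rw [hkk, ha]; ring
      _ ≤ β * 4 / (1 - γ) := by gcongr
      _ = 4 * β / (1 - γ) := by ring
  -- The exponential rates: `θ` per vertex, and `f` per unit of weight.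
  set f := t / 2 * (k : ℝ) ^ (2 * γ) with hf
  set θ := c * ((k : ℝ) ^ (2 * γ) / (N : ℝ) ^ γ) with hθ
  have hf0 : 0 < f := by positivity
  have hθ0 : 0 < θ := by positivity
  have hθt : θ ≤ t / 2 := by
    have : (k : ℝ) ^ (2 * γ) / (N : ℝ) ^ γ ≤ 1 := by
      rw [div_le_one (by positivity), Real.rpow_mul hkpos.le]
      refine Real.rpow_le_rpow (by positivity) ?_ hγ.le
      exact_mod_cast hkN
    exact (mul_le_of_le_one_right hc0.le this).trans hct
  have hwL : ∀ u ∉ L, f * w u ≤ t / 2 := by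
    intro u hu
    have hu : (k : ℝ) ^ 2 ≤ label u := by
      have : ¬ label u ≤ (k ^ 2 : ℕ) := by simpa [hL] using hu
      push_cast at this
      exact (not_le.1 this).le
    have h1 : w u ≤ ((k : ℝ) ^ (2 * γ))⁻¹ := by
      rw [← Real.rpow_neg hkpos.le, show -(2 * γ) = (2 : ℕ) * (-γ) by push_cast; ring,
        Real.rpow_mul hkpos.le, Real.rpow_natCast]
      exact Real.rpow_le_rpow_of_nonpos (by positivity) hu (by linarith)
    calc f * w u ≤ t / 2 * (k : ℝ) ^ (2 * γ) * ((k : ℝ) ^ (2 * γ))⁻¹ := by gcongr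
      _ = t / 2 := by field_simp
  have hbound := hG.real_not_explores_le (w := w) (g := fun u => θ + f * w u) (L := L) (a := a)
    (t := t) (ρ := ρ') (A := A) (θ := θ) (fun u => (hw0 u).le) ha0.le ht hρ'0.le hA0.le
    (fun u => by have := hw0 u; positivity) hp ?_ ?_ ?_ Finset.univ {x, y}
    (Finset.subset_univ _) ℓ
  · refine hbound.trans ?_
    have hwk : ∀ z : Fin N, (k : ℝ) ≤ label z → w z ≤ (k : ℝ) ^ (-γ) := fun z hz =>
      Real.rpow_le_rpow_of_nonpos hkpos hz (by linarith)
    have hkγ0 : 0 < (k : ℝ) ^ γ := by positivity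
    have hkγ : (k : ℝ) ^ (-γ) = ((k : ℝ) ^ γ)⁻¹ := Real.rpow_neg hkpos.le γ
    have hkγ1 : (k : ℝ) ^ (-γ) ≤ 1 := Real.rpow_le_one_of_one_le_of_nonpos hk1 (by linarith)
    have hwx := hwk x hx
    have hwy := hwk y hy
    rw [Finset.sum_pair hxy, Finset.sum_pair hxy, add_mul]
    refine add_le_add ?_ ?_
    · rw [mul_assoc]
      refine mul_le_mul_of_nonneg_left ?_ hA0.le
      have hwxy : 0 ≤ t * (w x + w y) := by have := hw0 x; have := hw0 y; positivity
      calc Real.exp (t * (w x + w y)) - 1 ≤ t * (w x + w y) * Real.exp (t * (w x + w y)) :=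
            exp_sub_one_le_mul_exp _
        _ ≤ t * ((k : ℝ) ^ (-γ) + (k : ℝ) ^ (-γ)) * Real.exp (t * (1 + 1)) := by
            gcongr
            exacts [hwx.trans hkγ1, hwy.trans hkγ1]
        _ = 2 * t * Real.exp (2 * t) * (k : ℝ) ^ (-γ) := by
            rw [show t * (1 + 1) = 2 * t by ring]; ring
    · have hfw : ∀ z : Fin N, w z ≤ (k : ℝ) ^ (-γ) → f * w z ≤ t / 2 * (k : ℝ) ^ γ := by
        intro z hz
        calc f * w z ≤ f * (k : ℝ) ^ (-γ) := by gcongr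
          _ = t / 2 * (k : ℝ) ^ γ := by
              rw [hf, mul_assoc, ← Real.rpow_add hkpos]; congr 2; ring
      have hθℓ : (t + 1) * (k : ℝ) ^ γ ≤ θ * ℓ := by
        calc (t + 1) * (k : ℝ) ^ γ = θ * ((t + 1) / c * ((N : ℝ) / k) ^ γ) := by
              rw [hθ, Real.div_rpow hNpos.le hkpos.le, two_mul, Real.rpow_add hkpos]
              field_simp
          _ ≤ θ * ℓ := by gcongr
      have hinv : Real.exp (-(k : ℝ) ^ γ) ≤ (k : ℝ) ^ (-γ) := by
        rw [hkγ]; exact exp_neg_le_inv hkγ0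
      calc Real.exp (θ + f * w x + (θ + f * w y) - θ * ℓ)
          ≤ Real.exp (t + -(k : ℝ) ^ γ) := by
            refine Real.exp_le_exp.2 ?_
            have := hfw x hwx
            have := hfw y hwy
            linarith
        _ ≤ Real.exp t * (k : ℝ) ^ (-γ) := by rw [Real.exp_add]; gcongr
  · intro s
    calc ∑ u, a * w s * w u * (Real.exp (t * w u) - 1)
        ≤ ∑ u, a * w s * w u * (κ * (t * w u)) := by
          refine Finset.sum_le_sum fun u _ => mul_le_mul_of_nonneg_left
            (hexp _ (mul_nonneg ht.le (hw0 u).le) (mul_le_of_le_one_right ht.le (hw1 u)))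
            (mul_nonneg (mul_nonneg ha0.le (hw0 s).le) (hw0 u).le)
      _ = t * κ * w s * (a * ∑ u, w u ^ 2) := by
          rw [Finset.mul_sum, Finset.mul_sum]
          exact Finset.sum_congr rfl fun u _ => by ring
      _ ≤ t * κ * w s * ρ := by have := hw0 s; gcongr
      _ = t * ρ' * w s := by rw [← hκρ]; ring
  · intro s
    have hstep : ∑ u ∈ Lᶜ, a * w s * w u * (Real.exp (θ + f * w u) - 1) ≤ f * w s := by
      calc ∑ u ∈ Lᶜ, a * w s * w u * (Real.exp (θ + f * w u) - 1)
          ≤ ∑ u ∈ Lᶜ, a * w s * w u * (κ * (θ + f * w u)) := by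
            refine Finset.sum_le_sum fun u hu => mul_le_mul_of_nonneg_left
              (hexp _ (by have := hw0 u; positivity) ?_)
              (mul_nonneg (mul_nonneg ha0.le (hw0 s).le) (hw0 u).le)
            have := hwL u (by simpa using hu)
            linarith
        _ ≤ ∑ u, a * w s * w u * (κ * (θ + f * w u)) := by
            refine Finset.sum_le_sum_of_subset_of_nonneg (Finset.subset_univ _) fun u _ _ => ?_
            have := hw0 u
            have := hw0 s
            positivity
        _ = w s * (κ * θ * (a * ∑ u, w u) + κ * f * (a * ∑ u, w u ^ 2)) := by
            simp only [Finset.mul_sum, ← Finset.sum_add_distrib]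
            exact Finset.sum_congr rfl fun u _ => by ring
        _ ≤ w s * (κ * θ * (c₁ * (N : ℝ) ^ γ) + κ * f * ρ) := by
            have := hw0 s
            gcongr
        _ ≤ w s * f := by
            refine mul_le_mul_of_nonneg_left ?_ (hw0 s).le
            have h1 : κ * θ * (c₁ * (N : ℝ) ^ γ) = κ * c * c₁ * (k : ℝ) ^ (2 * γ) := by
              rw [hθ]; field_simp
            have h2 : κ * c * c₁ * (k : ℝ) ^ (2 * γ) ≤ (1 - ρ') * f := by
              calc _ ≤ (1 - ρ') * (t / 2) * (k : ℝ) ^ (2 * γ) := by gcongr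
                _ = (1 - ρ') * f := by rw [hf]; ring
            have h3 : κ * f * ρ = ρ' * f := by rw [← hκρ]; ring
            rw [h1, h3]
            linarith
        _ = f * w s := mul_comm _ _
    linarith
  · have hAe : A * (t * (1 - ρ')) = β / t + 4 * β / (1 - γ) :=
      div_mul_cancel₀ _ (mul_pos ht hρ'1).ne'
    rw [hAe]
    gcongr

end ChungLu

/-! ### Existence of a double star -/

section GoodPair

/-- `IsGoodPair k r ℓ bx b H x y`: the vertices `x` and `y` of `H` are adjacent, their labels lie in
`(k, 2k]` and `(2k, kr]`, their degrees exceed `bx` and `b`, and an exploration of the graph without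
the edge `xy` shows that the rest of the component has no cycle and that the component has at most
`ℓ` vertices. -/
def IsGoodPair {N : ℕ} (k r ℓ : ℕ) (bx b : ℝ) (H : SimpleGraph (Fin N)) (x y : Fin N) : Prop :=
  H.Adj x y ∧ (k ≤ (x : ℕ) ∧ (x : ℕ) < 2 * k) ∧ (2 * k ≤ (y : ℕ) ∧ (y : ℕ) < k * r) ∧
    (∃ L D, Explores (H.deleteEdges {s(x, y)}) L Finset.univ {x, y} D ∧ D.card ≤ ℓ) ∧
    bx < deg H x ∧ b < deg H y

lemma card_filter_val {N a b : ℕ} (hb : b ≤ N) :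
    (Finset.univ.filter fun i : Fin N => a ≤ (i : ℕ) ∧ (i : ℕ) < b).card = b - a := by
  rw [← Nat.card_Ico a b]
  refine Finset.card_bij (fun i _ => (i : ℕ)) ?_ (fun i _ j _ h => Fin.ext h) ?_
  · intro i hi
    simpa using hi
  · intro j hj
    rw [Finset.mem_Ico] at hj
    exact ⟨⟨j, hj.2.trans_le hb⟩, by simpa using hj, rfl⟩

lemma deg_eq_card_filter {N : ℕ} (H : SimpleGraph (Fin N)) (z : Fin N) [DecidablePred (H.Adj z)] :
    deg H z = (Finset.univ.filter (H.Adj z)).card := by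
  classical
  unfold deg
  rw [← SimpleGraph.card_neighborFinset_eq_degree]
  congr 2
  ext u
  simp

lemma deg_deleteEdges_le {N : ℕ} (H : SimpleGraph (Fin N)) (T : Set (Sym2 (Fin N))) (z : Fin N) :
    deg (H.deleteEdges T) z ≤ deg H z := by
  classical
  rw [deg_eq_card_filter, deg_eq_card_filter]
  exact Nat.cast_le.2 (Finset.card_le_card (Finset.monotone_filter_right _ fun u _ hu =>
    SimpleGraph.deleteEdges_le _ hu))

variable {N : ℕ} {Ω : Type} [MeasurableSpace Ω] {μ : Measure Ω} [IsProbabilityMeasure μ]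
  {G : Ω → SimpleGraph (Fin N)} {β γ : ℝ}

/-- Vertices with small labels have large degrees. The sum of the edge probabilities is bounded
below through the weight `N^(-γ)` of the last vertex. -/
lemma real_degree_deleteEdges_le (hβ : 0 < β) (hγ : 0 < γ) (hN : 4 ≤ N) (hG : IndepEdges μ G)
    (hp : ∀ s u, s ≠ u → μ.real {ω | (G ω).Adj s u}
      = β * (N : ℝ) ^ (2 * γ - 1) * label s ^ (-γ) * label u ^ (-γ)) (x y : Fin N)
    {z : Fin N} (hz : z ∈ ({x, y} : Finset (Fin N))) {b : ℝ} (hzb : label z ≤ b) :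
    μ.real {ω | deg ((G ω).deleteEdges {s(x, y)}) z ≤ β / 8 * (N / b) ^ γ}
      ≤ Real.exp (-(β / 8 * (N / b) ^ γ)) := by
  classical
  have hNpos : (0 : ℝ) < N := by positivity
  have hb : 0 < b := (label_pos z).trans_le hzb
  have hm : β / 2 * (N / b) ^ γ / 4 = β / 8 * (N / b) ^ γ := by ring
  have hsum : β / 2 * (N / b) ^ γ
      ≤ ∑ u ∈ Finset.univ.erase z, μ.real {ω | ((G ω).deleteEdges {s(x, y)}).Adj z u} := by
    have hterm : ∀ u ∈ Finset.univ \ ({x, y} : Finset (Fin N)),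
        β * (N : ℝ) ^ (2 * γ - 1) * label z ^ (-γ) * (N : ℝ) ^ (-γ)
          ≤ μ.real {ω | ((G ω).deleteEdges {s(x, y)}).Adj z u} := by
      intro u hu
      simp only [Finset.mem_sdiff, Finset.mem_univ, true_and] at hu
      have hne : s(z, u) ≠ s(x, y) := by
        intro h
        rcases Sym2.eq_iff.1 h with ⟨-, rfl⟩ | ⟨-, rfl⟩ <;> simp at hu
      have hset : {ω | ((G ω).deleteEdges {s(x, y)}).Adj z u} = {ω | (G ω).Adj z u} := by
        ext ω
        exact SimpleGraph.deleteEdges_adj.trans (and_iff_left hne)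
      rw [hset, hp z u fun h => hu (h ▸ hz)]
      have h0 : 0 < label z ^ (-γ) := Real.rpow_pos_of_pos (label_pos z) _
      have := Real.rpow_le_rpow_of_nonpos (label_pos u) (label_le u) (by linarith : -γ ≤ 0)
      gcongr
    have hcard : (N : ℝ) / 2 ≤ (Finset.univ \ ({x, y} : Finset (Fin N))).card := by
      have h1 : N - 2 ≤ (Finset.univ \ ({x, y} : Finset (Fin N))).card := by
        have h2 := Finset.le_card_sdiff ({x, y} : Finset (Fin N)) Finset.univ
        have h3 : ({x, y} : Finset (Fin N)).card ≤ 2 := Finset.card_le_two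
        rw [Finset.card_univ, Fintype.card_fin] at h2
        omega
      have h4 : (N : ℝ) - 2 ≤ (Finset.univ \ ({x, y} : Finset (Fin N))).card := by
        have : N ≤ (Finset.univ \ ({x, y} : Finset (Fin N))).card + 2 := by omega
        have : (N : ℝ) ≤ (Finset.univ \ ({x, y} : Finset (Fin N))).card + 2 := by exact_mod_cast this
        linarith
      have : (4 : ℝ) ≤ N := by exact_mod_cast hN
      linarith
    have h0 : 0 < label z ^ (-γ) := Real.rpow_pos_of_pos (label_pos z) _
    calc β / 2 * (N / b) ^ γ = β / 2 * ((N : ℝ) ^ γ * b ^ (-γ)) := by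
          rw [Real.div_rpow hNpos.le hb.le, Real.rpow_neg hb.le]; rfl
      _ ≤ β / 2 * ((N : ℝ) ^ γ * label z ^ (-γ)) := by
          have := Real.rpow_le_rpow_of_nonpos (label_pos z) hzb (by linarith : -γ ≤ 0)
          gcongr
      _ = (N : ℝ) / 2 * (β * (N : ℝ) ^ (2 * γ - 1) * label z ^ (-γ) * (N : ℝ) ^ (-γ)) := by
          have : (N : ℝ) ^ γ = N * (N : ℝ) ^ (2 * γ - 1) * (N : ℝ) ^ (-γ) := by
            rw [← Real.rpow_one_add' hNpos.le (by ring_nf; positivity), ← Real.rpow_add hNpos]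
            congr 1; ring
          rw [this]; ring
      _ ≤ (Finset.univ \ ({x, y} : Finset (Fin N))).card *
            (β * (N : ℝ) ^ (2 * γ - 1) * label z ^ (-γ) * (N : ℝ) ^ (-γ)) := by gcongr
      _ ≤ ∑ u ∈ Finset.univ \ ({x, y} : Finset (Fin N)),
            μ.real {ω | ((G ω).deleteEdges {s(x, y)}).Adj z u} := by
          rw [← nsmul_eq_mul]
          exact Finset.card_nsmul_le_sum _ _ _ hterm
      _ ≤ _ := by
          refine Finset.sum_le_sum_of_subset_of_nonneg (fun u hu => ?_)
            fun u _ _ => measureReal_nonneg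
          simp only [Finset.mem_sdiff, Finset.mem_univ, true_and] at hu
          exact Finset.mem_erase.2 ⟨fun h => hu (h ▸ hz), Finset.mem_univ u⟩
  rw [← hm]
  simp_rw [deg_eq_card_filter]
  convert (hG.deleteEdges x y).real_degree_le z hsum

/-- The probability that a set of potential edges is entirely absent. -/
lemma IndepEdges.real_forall_not_adj_le (hG : IndepEdges μ G) (A B : Finset (Fin N))
    (hAB : ∀ x ∈ A, ∀ y ∈ B, x < y) {p : ℝ}
    (hp : ∀ x ∈ A, ∀ y ∈ B, p ≤ μ.real {ω | (G ω).Adj x y}) :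
    μ.real {ω | ∀ x ∈ A, ∀ y ∈ B, ¬ (G ω).Adj x y} ≤ Real.exp (-(A.card * B.card * p)) := by
  have hlt : ∀ z : A ×ˢ B, z.1.1 < z.1.2 := fun z =>
    hAB _ (Finset.mem_product.1 z.2).1 _ (Finset.mem_product.1 z.2).2
  have hinj : Function.Injective fun z : A ×ˢ B =>
      (⟨z.1, hlt z⟩ : {e : Fin N × Fin N // e.1 < e.2}) := fun z z' h =>
    Subtype.ext (congrArg (fun e : {e : Fin N × Fin N // e.1 < e.2} => e.1) h)
  have h := (hG.iIndepSet_adj.precomp hinj).real_forall_iff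
    (fun z => hG.measurableSet_adj _) (∅ : Set (A ×ˢ B))
  have hset : {ω | ∀ x ∈ A, ∀ y ∈ B, ¬ (G ω).Adj x y} = {ω | ∀ z : A ×ˢ B,
      (ω ∈ ((fun e : {e : Fin N × Fin N // e.1 < e.2} => {ω | (G ω).Adj e.1.1 e.1.2}) ∘
        fun z : A ×ˢ B => (⟨z.1, hlt z⟩ : {e : Fin N × Fin N // e.1 < e.2})) z ↔
        z ∈ (∅ : Set (A ×ˢ B)))} := by
    ext ω
    simp only [Set.mem_ofPred_eq, Function.comp, Set.mem_empty_iff_false, iff_false, Subtype.forall,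
      Finset.mem_product, Prod.forall]
    exact ⟨fun h x y hxy => h x hxy.1 y hxy.2, fun h x hx y hy => h x y ⟨hx, hy⟩⟩
  rw [hset, h]
  simp only [Set.mem_empty_iff_false, if_false, Function.comp]
  calc ∏ z : A ×ˢ B, (1 - μ.real {ω | (G ω).Adj z.1.1 z.1.2})
      ≤ ∏ _z : A ×ˢ B, Real.exp (-p) := by
        refine Finset.prod_le_prod (fun z _ => sub_nonneg.2 measureReal_le_one) fun z _ => ?_
        have h1 := hp _ (Finset.mem_product.1 z.2).1 _ (Finset.mem_product.1 z.2).2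
        have h2 := Real.add_one_le_exp (-p)
        linarith
    _ = Real.exp (-(A.card * B.card * p)) := by
        rw [Finset.prod_const, ← Real.exp_nat_mul, Finset.card_univ, Fintype.card_coe,
          Finset.card_product]
        push_cast
        ring_nf

/-- A good pair exists except with probability `exp (- β (r - 2) / (2 r)^γ) + O(r k^(-γ))`: some
edge joins `(k, 2k]` to `(2k, kr]`, and the expected number of such edges that fail to be good pairs
is small, because the presence of an edge is independent of the exploration of the rest of the
graph. -/
theorem exists_real_not_isGoodPair_le (hβ : 0 < β) (hγ : 0 < γ) (hsub : β + 2 * γ < 1) :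
    ∃ C C₁ : ℝ, 0 < C ∧ 0 < C₁ ∧ ∀ (N k r ℓ : ℕ), 4 ≤ N → 1 ≤ k → 3 ≤ r → k ^ 2 * r ≤ N →
      1 ≤ (N : ℝ) ^ (2 * γ - 1) * (k : ℝ) ^ (2 - 2 * γ) →
      (N : ℝ) ^ (2 * γ - 1) * (k : ℝ) ^ (2 - 2 * γ) ≤ 4 → C * ((N : ℝ) / k) ^ γ ≤ ℓ →
      ∀ {Ω : Type} [MeasurableSpace Ω] (μ : Measure Ω) [IsProbabilityMeasure μ]
        (G : Ω → SimpleGraph (Fin N)), IndepEdges μ G →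
        (∀ s u, s ≠ u → μ.real {ω | (G ω).Adj s u}
          = β * (N : ℝ) ^ (2 * γ - 1) * label s ^ (-γ) * label u ^ (-γ)) →
          μ.real {ω | ¬ ∃ x y, IsGoodPair k r ℓ (β / 8 * ((N : ℝ) / (2 * k)) ^ γ)
            (β / 8 * ((N : ℝ) / (k * r)) ^ γ) (G ω) x y}
          ≤ Real.exp (-(β * ((r - 2) * (2 * r : ℝ) ^ (-γ)))) + C₁ * (r * (k : ℝ) ^ (-γ)) := by
  classical
  obtain ⟨C, C₀, hC, hC₀, hexpl⟩ := exists_real_not_explores_le hβ hγ hsub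
  refine ⟨C, 4 * β * (C₀ + 2 * (8 / β)), hC, by positivity, ?_⟩
  intro N k r ℓ hN hk hr hkr hlow hhigh hℓ Ω _ μ _ G hG hp
  have hNpos : (0 : ℝ) < N := by positivity
  have hkpos : (0 : ℝ) < k := by exact_mod_cast hk
  have hk1 : (1 : ℝ) ≤ k := by exact_mod_cast hk
  have hr3 : (3 : ℝ) ≤ r := by exact_mod_cast hr
  have hkrN : k * r ≤ N := (Nat.mul_le_mul_right r (by nlinarith : k ≤ k ^ 2)).trans hkr
  have h2kr : 2 * k ≤ k * r := by nlinarith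
  set a := β * (N : ℝ) ^ (2 * γ - 1) with ha
  have ha0 : 0 < a := by positivity
  set A : Finset (Fin N) := Finset.univ.filter fun i => k ≤ (i : ℕ) ∧ (i : ℕ) < 2 * k with hA
  set B : Finset (Fin N) := Finset.univ.filter fun i => 2 * k ≤ (i : ℕ) ∧ (i : ℕ) < k * r with hB
  have hAcard : A.card = k := by rw [hA, card_filter_val (by omega)]; omega
  have hBcard : B.card = k * r - 2 * k := card_filter_val hkrN
  have hAB : ∀ x ∈ A, ∀ y ∈ B, x < y := by
    intro x hx y hy
    have h1 := (Finset.mem_filter.1 hx).2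
    have h2 := (Finset.mem_filter.1 hy).2
    exact Fin.lt_def.2 (by omega)
  have hAl : ∀ x ∈ A, (k : ℝ) ≤ label x ∧ label x ≤ 2 * k := by
    intro x hx
    have h1 := (Finset.mem_filter.1 hx).2
    unfold label
    exact ⟨by exact_mod_cast (by omega : k ≤ (x : ℕ) + 1),
      by exact_mod_cast (by omega : (x : ℕ) + 1 ≤ 2 * k)⟩
  have hBl : ∀ y ∈ B, (k : ℝ) ≤ label y ∧ label y ≤ k * r := by
    intro y hy
    have h1 := (Finset.mem_filter.1 hy).2
    unfold label
    exact ⟨by exact_mod_cast (by omega : k ≤ (y : ℕ) + 1),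
      by exact_mod_cast (by omega : (y : ℕ) + 1 ≤ k * r)⟩
  set bx := β / 8 * ((N : ℝ) / (2 * k)) ^ γ with hbx
  set b := β / 8 * ((N : ℝ) / (k * r)) ^ γ with hb
  set Bad : Fin N → Fin N → SimpleGraph (Fin N) → Prop := fun x y H =>
    (¬ ∃ D, Explores H (Finset.univ.filter fun u => label u ≤ (k ^ 2 : ℕ)) Finset.univ {x, y} D ∧
      D.card ≤ ℓ) ∨ deg H x ≤ bx ∨ deg H y ≤ b with hBad
  have hk2 : (k : ℝ) ^ (2 - 2 * γ) = k * k * ((k : ℝ) ^ (-γ) * (k : ℝ) ^ (-γ)) := by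
    rw [← Real.rpow_add hkpos, ← sq, ← Real.rpow_natCast, ← Real.rpow_add hkpos]
    congr 1; push_cast; ring
  have hkγ : (k : ℝ) ^ (-γ) = ((k : ℝ) ^ γ)⁻¹ := Real.rpow_neg hkpos.le γ
  have hkγ0 : 0 < (k : ℝ) ^ γ := by positivity
  have hlabel : ∀ {z : Fin N}, (k : ℝ) ≤ label z → label z ^ (-γ) ≤ (k : ℝ) ^ (-γ) := fun hz =>
    Real.rpow_le_rpow_of_nonpos hkpos hz (by linarith)
  have hl0 : ∀ z : Fin N, 0 < label z ^ (-γ) := fun z => Real.rpow_pos_of_pos (label_pos z) _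
  -- Degrees are at least of order `k ^ γ`, because `k * (k * r) ≤ N`.
  have hdeg : ∀ c : ℝ, 0 < c → c ≤ k * r →
      Real.exp (-(β / 8 * ((N : ℝ) / c) ^ γ)) ≤ 8 / β * (k : ℝ) ^ (-γ) := by
    intro c hc hcr
    have hkc : (k : ℝ) ≤ N / c := by
      rw [le_div_iff₀ hc]
      calc (k : ℝ) * c ≤ k * (k * r) := by gcongr
        _ = ((k ^ 2 * r : ℕ) : ℝ) := by push_cast; ring
        _ ≤ N := by exact_mod_cast hkr
    calc Real.exp (-(β / 8 * ((N : ℝ) / c) ^ γ)) ≤ Real.exp (-(β / 8 * (k : ℝ) ^ γ)) := by gcongr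
      _ ≤ (β / 8 * (k : ℝ) ^ γ)⁻¹ := exp_neg_le_inv (by positivity)
      _ = 8 / β * (k : ℝ) ^ (-γ) := by rw [hkγ, mul_inv, inv_div]
  have hbad : ∀ x ∈ A, ∀ y ∈ B, μ.real {ω | (G ω).Adj x y ∧
      Bad x y ((G ω).deleteEdges {s(x, y)})}
      ≤ a * (k : ℝ) ^ (-γ) * (k : ℝ) ^ (-γ) * ((C₀ + 2 * (8 / β)) * (k : ℝ) ^ (-γ)) := by
    intro x hx y hy
    have hxy : x ≠ y := (hAB x hx y hy).ne
    rw [hG.real_adj_inter_deleteEdges hxy, hp x y hxy]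
    have h1 : μ.real {ω | ¬ ∃ D, Explores ((G ω).deleteEdges {s(x, y)})
        (Finset.univ.filter fun u => label u ≤ (k ^ 2 : ℕ)) Finset.univ {x, y} D ∧ D.card ≤ ℓ}
        ≤ C₀ * (k : ℝ) ^ (-γ) := by
      refine hexpl N k ℓ (by omega) hk ((Nat.le_mul_of_pos_right _ (by omega)).trans hkr) hhigh hℓ
        μ _ (hG.deleteEdges x y) (fun s u hsu => ?_) x y hxy (hAl x hx).1 (hBl y hy).1
      rw [← ha, ← hp s u hsu]
      exact measureReal_mono (fun ω hω => SimpleGraph.deleteEdges_le _ hω) (measure_ne_top _ _)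
    have h2 := (real_degree_deleteEdges_le hβ hγ hN hG hp x y (z := x) (by simp)
      (hAl x hx).2).trans (hdeg (2 * k) (by positivity) (by exact_mod_cast h2kr))
    have h3 := (real_degree_deleteEdges_le hβ hγ hN hG hp x y (z := y) (by simp)
      (hBl y hy).2).trans (hdeg (k * r) (by positivity) le_rfl)
    have h4 : μ.real {ω | Bad x y ((G ω).deleteEdges {s(x, y)})}
        ≤ (C₀ + 2 * (8 / β)) * (k : ℝ) ^ (-γ) := by
      have h5 := (measureReal_union_le _ _).trans (add_le_add h1
        ((measureReal_union_le _ _).trans (add_le_add h2 h3)))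
      refine le_trans (le_of_eq rfl) (h5.trans_eq ?_)
      ring
    have h5 := hlabel (hAl x hx).1
    have h6 := hlabel (hBl y hy).1
    have h7 := hl0 x
    have h8 := hl0 y
    gcongr
  have hnone : μ.real {ω | ∀ x ∈ A, ∀ y ∈ B, ¬ (G ω).Adj x y}
      ≤ Real.exp (-(β * ((r - 2) * (2 * r : ℝ) ^ (-γ)))) := by
    refine (hG.real_forall_not_adj_le A B hAB
      (p := a * (2 * k : ℝ) ^ (-γ) * (k * r : ℝ) ^ (-γ)) fun x hx y hy => ?_).trans ?_
    · rw [hp x y (hAB x hx y hy).ne]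
      have h1 := Real.rpow_le_rpow_of_nonpos (label_pos x) (hAl x hx).2 (by linarith : -γ ≤ 0)
      have h2 := Real.rpow_le_rpow_of_nonpos (label_pos y) (hBl y hy).2 (by linarith : -γ ≤ 0)
      have h7 := hl0 x
      gcongr
    · rw [hAcard, hBcard, Nat.cast_sub h2kr, Real.exp_le_exp, neg_le_neg_iff]
      push_cast
      rw [Real.mul_rpow (by norm_num) hkpos.le, Real.mul_rpow hkpos.le (by positivity),
        Real.mul_rpow (by norm_num) (by positivity)]
      have h0 : 0 ≤ (r - 2 : ℝ) * ((2 : ℝ) ^ (-γ) * (r : ℝ) ^ (-γ)) :=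
        mul_nonneg (by linarith) (by positivity)
      calc β * ((r - 2 : ℝ) * ((2 : ℝ) ^ (-γ) * (r : ℝ) ^ (-γ)))
          ≤ β * (((N : ℝ) ^ (2 * γ - 1) * (k : ℝ) ^ (2 - 2 * γ)) *
              ((r - 2 : ℝ) * ((2 : ℝ) ^ (-γ) * (r : ℝ) ^ (-γ)))) := by
            exact mul_le_mul_of_nonneg_left (le_mul_of_one_le_left h0 hlow) hβ.le
        _ = _ := by rw [hk2, ha]; ring
  have hsub : {ω | ¬ ∃ x y, IsGoodPair k r ℓ bx b (G ω) x y} ⊆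
      {ω | ∀ x ∈ A, ∀ y ∈ B, ¬ (G ω).Adj x y} ∪
        ⋃ z ∈ A ×ˢ B, {ω | (G ω).Adj z.1 z.2 ∧ Bad z.1 z.2 ((G ω).deleteEdges {s(z.1, z.2)})} := by
    intro ω hω
    by_contra hcon
    simp only [Set.mem_union, Set.mem_iUnion, Set.mem_ofPred_eq, not_or, not_exists, not_and,
      Finset.mem_product, Prod.forall] at hcon
    obtain ⟨hedge, hgood⟩ := hcon
    push Not at hedge
    obtain ⟨x, hx, y, hy, hxy⟩ := hedge
    have h := hgood x y ⟨hx, hy⟩ hxy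
    simp only [hBad, not_or, not_not, not_le] at h
    obtain ⟨⟨D, hD⟩, h2, h3⟩ := h
    exact hω ⟨x, y, hxy, (Finset.mem_filter.1 hx).2, (Finset.mem_filter.1 hy).2, ⟨_, D, hD⟩,
      h2.trans_le (deg_deleteEdges_le _ _ x), h3.trans_le (deg_deleteEdges_le _ _ y)⟩
  refine (measureReal_mono hsub (measure_ne_top _ _)).trans
    ((measureReal_union_le _ _).trans (add_le_add hnone ?_))
  have hABcard : ((A ×ˢ B).card : ℝ) ≤ k * (k * r) := by
    rw [Finset.card_product, hAcard, hBcard]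
    exact_mod_cast Nat.mul_le_mul_left k (Nat.sub_le _ _)
  set q := a * (k : ℝ) ^ (-γ) * (k : ℝ) ^ (-γ) * ((C₀ + 2 * (8 / β)) * (k : ℝ) ^ (-γ)) with hq
  have hq0 : 0 ≤ q := by positivity
  have hbad' : ∀ z ∈ A ×ˢ B,
      μ.real {ω | (G ω).Adj z.1 z.2 ∧ Bad z.1 z.2 ((G ω).deleteEdges {s(z.1, z.2)})} ≤ q :=
    fun z hz => hbad z.1 (Finset.mem_product.1 hz).1 z.2 (Finset.mem_product.1 hz).2
  refine (measureReal_biUnion_finset_le _ _).trans ((Finset.sum_le_sum hbad').trans ?_)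
  rw [Finset.sum_const, nsmul_eq_mul]
  calc ((A ×ˢ B).card : ℝ) * q ≤ k * (k * r) * q := mul_le_mul_of_nonneg_right hABcard hq0
    _ = β * ((N : ℝ) ^ (2 * γ - 1) * (k : ℝ) ^ (2 - 2 * γ)) *
          ((C₀ + 2 * (8 / β)) * (r * (k : ℝ) ^ (-γ))) := by rw [hk2, hq, ha]; ring
    _ ≤ β * 4 * ((C₀ + 2 * (8 / β)) * (r * (k : ℝ) ^ (-γ))) := by gcongr
    _ = 4 * β * (C₀ + 2 * (8 / β)) * (r * (k : ℝ) ^ (-γ)) := by ring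

end GoodPair

/-! ### Transfer from the Chung-Lu graph -/

section Transfer

lemma chungLu_eq {β γ : ℝ} (hγ : 0 < γ) {N : ℕ+}
    (ha : β * (N : ℝ) ^ (2 * γ - 1) ≤ 1) (i j : Fin N) :
    chungLu β γ N i j = β * (N : ℝ) ^ (2 * γ - 1) * label i ^ (-γ) * label j ^ (-γ) := by
  have h1 : ∀ i : Fin N, 1 ≤ label i ^ γ := fun i => Real.one_le_rpow (one_le_label i) hγ.le
  unfold chungLu
  rw [min_eq_left, Real.rpow_neg (label_pos i).le, Real.rpow_neg (label_pos j).le]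
  · rw [div_eq_mul_inv, mul_inv]; ring
  · exact div_le_one_of_le₀ (ha.trans (one_le_mul_of_one_le_of_one_le (h1 i) (h1 j)))
      (mul_nonneg (zero_le_one.trans (h1 i)) (zero_le_one.trans (h1 j)))

/-- A bound on the probability of an event that holds for Chung-Lu graphs gives one for every random
graph whose edge probabilities are close to the Chung-Lu probabilities. -/
lemma sq_real_le_of_chungLu {β γ : ℝ} (hβ : 0 < β) (hγ : 0 < γ) {N : ℕ+}
    (ha : β * (N : ℝ) ^ (2 * γ - 1) ≤ 1 / 2) {Ω : Type*} [MeasurableSpace Ω] {μ : Measure Ω}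
    [IsProbabilityMeasure μ] {G : Ω → SimpleGraph (Fin N)} (hG : IndepEdges μ G)
    {q : Fin N → Fin N → ℝ} (hq : ∀ i j, i ≠ j → μ.real {ω | (G ω).Adj i j} = q i j)
    (hsum : ∑ i : Fin N, ∑ j : Fin N with i ≠ j,
      (chungLu β γ N i j - q i j) ^ 2 / chungLu β γ N i j ≤ 1)
    (B : SimpleGraph (Fin N) → Prop) {ε : ℝ}
    (hB : ∀ {Ω' : Type} [MeasurableSpace Ω'] (ν : Measure Ω') [IsProbabilityMeasure ν]
      (G' : Ω' → SimpleGraph (Fin N)), IndepEdges ν G' →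
      (∀ s u, s ≠ u → ν.real {ω | (G' ω).Adj s u}
        = β * (N : ℝ) ^ (2 * γ - 1) * label s ^ (-γ) * label u ^ (-γ)) →
      ν.real {ω | B (G' ω)} ≤ ε) :
    μ.real {ω | B (G ω)} ^ 2 ≤ Real.exp 2 * ε := by
  have hN : (0 : ℝ) < N := by exact_mod_cast N.pos
  have hp := chungLu_eq hγ (ha.trans (by norm_num))
  have hl0 : ∀ i : Fin N, 0 < label i ^ (-γ) := fun i => Real.rpow_pos_of_pos (label_pos i) _
  have hl1 : ∀ i : Fin N, label i ^ (-γ) ≤ 1 := fun i =>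
    Real.rpow_le_one_of_one_le_of_nonpos (one_le_label i) (by linarith)
  have hp0 : ∀ i j, 0 < chungLu β γ N i j := fun i j => by
    rw [hp]; have := hl0 i; have := hl0 j; positivity
  have hp2 : ∀ i j, chungLu β γ N i j ≤ 1 / 2 := fun i j => by
    rw [hp]
    have h1 : 0 ≤ β * (N : ℝ) ^ (2 * γ - 1) := by positivity
    exact ((mul_le_of_le_one_right (mul_nonneg h1 (hl0 i).le) (hl1 j)).trans
      (mul_le_of_le_one_right h1 (hl1 i))).trans ha
  obtain ⟨ν, G', hν, hG', hadj⟩ := exists_indepEdges (chungLu β γ N)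
    (fun i j => by rw [hp, hp]; ring) (fun i j => (hp0 i j).le)
    (fun i j => (hp2 i j).trans (by norm_num))
  have hcmp := hG.sq_real_le hG'
    (fun e => by rw [hadj _ _ e.2.ne]; exact ⟨hp0 _ _, (hp2 _ _).trans_lt (by norm_num)⟩) B
  refine hcmp.trans (mul_le_mul (Real.exp_le_exp.2 ?_)
    (hB ν G' hG' fun s u hsu => by rw [hadj s u hsu, hp]) measureReal_nonneg (Real.exp_pos _).le)
  set F : Fin N × Fin N → ℝ := fun z =>
    (chungLu β γ N z.1 z.2 - q z.1 z.2) ^ 2 / chungLu β γ N z.1 z.2 with hF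
  have hF0 : ∀ z, 0 ≤ F z := fun z => div_nonneg (sq_nonneg _) (hp0 _ _).le
  calc ∑ e : {e : Fin N × Fin N // e.1 < e.2},
        (μ.real {ω | (G ω).Adj e.1.1 e.1.2} - ν.real {ω | (G' ω).Adj e.1.1 e.1.2}) ^ 2 /
          (ν.real {ω | (G' ω).Adj e.1.1 e.1.2} * (1 - ν.real {ω | (G' ω).Adj e.1.1 e.1.2}))
      ≤ ∑ e : {e : Fin N × Fin N // e.1 < e.2}, 2 * F e.1 := by
        refine Finset.sum_le_sum fun e _ => ?_
        rw [hadj _ _ e.2.ne, hq _ _ e.2.ne]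
        have h0 := hp0 e.1.1 e.1.2
        have h2 := hp2 e.1.1 e.1.2
        rw [hF, ← mul_div_assoc, div_le_div_iff₀ (mul_pos h0 (by linarith)) h0]
        have hs := mul_nonneg (sq_nonneg (chungLu β γ N e.1.1 e.1.2 - q e.1.1 e.1.2)) h0.le
        nlinarith [mul_nonneg hs (by linarith : 0 ≤ 1 / 2 - chungLu β γ N e.1.1 e.1.2)]
    _ = 2 * ∑ z : Fin N × Fin N with z.1 < z.2, F z := by
        rw [← Finset.mul_sum]
        congr 1
        exact (Finset.sum_subtype _ (fun z => by simp) F).symm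
    _ ≤ 2 * ∑ z : Fin N × Fin N with z.1 ≠ z.2, F z := by
        refine mul_le_mul_of_nonneg_left (Finset.sum_le_sum_of_subset_of_nonneg
          (Finset.monotone_filter_right _ fun z _ hz => ?_) fun z _ _ => hF0 z) (by norm_num)
        exact ne_of_lt hz
    _ = 2 * ∑ i : Fin N, ∑ j : Fin N with i ≠ j, F (i, j) := by
        simp only [Finset.sum_filter, Fintype.sum_prod_type]
    _ ≤ 2 := by linarith

end Transfer

section WHP

variable {Ω : ℕ+ → Type*} [∀ N, MeasurableSpace (Ω N)] {P : ∀ N, Measure (Ω N)}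
  [∀ N, IsProbabilityMeasure (P N)]

lemma WHP.of_eventually_imp {E A : ∀ N, Ω N → Prop}
    (hE : Tendsto (fun N => (P N).real {ω | ¬ E N ω}) atTop (𝓝 0))
    (hEA : ∀ᶠ N in atTop, ∀ ω, E N ω → A N ω) : WHP P A := by
  have hE' : Tendsto (fun N => P N {ω | ¬ E N ω}) atTop (𝓝 0) := by
    simpa using ENNReal.tendsto_ofReal hE
  have hlow : Tendsto (fun N => 1 - P N {ω | ¬ E N ω}) atTop (𝓝 1) := by
    simpa using ENNReal.Tendsto.sub (tendsto_const_nhds (x := (1 : ENNReal))) hE'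
      (Or.inl ENNReal.one_ne_top)
  refine tendsto_of_tendsto_of_tendsto_of_le_of_le' hlow tendsto_const_nhds ?_
    (Eventually.of_forall fun N => prob_le_one)
  filter_upwards [hEA] with N hN
  rw [tsub_le_iff_right, ← measure_univ (μ := P N)]
  refine (measure_mono fun ω _ => ?_).trans (measure_union_le _ _)
  by_cases h : E N ω
  · exact Or.inl (hN ω h)
  · exact Or.inr h

end WHP

lemma sum_rpow_le_rpow_sum {ι : Type*} (s : Finset ι) {f : ι → ℝ} (hf : ∀ i, 0 ≤ f i) {η : ℝ}
    (hη : 1 ≤ η) : ∑ i ∈ s, f i ^ η ≤ (∑ i ∈ s, f i) ^ η := by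
  classical
  induction s using Finset.induction_on with
  | empty => simp [Real.zero_rpow (by linarith : η ≠ 0)]
  | insert i s hi ih =>
    rw [Finset.sum_insert hi, Finset.sum_insert hi]
    exact (add_le_add_right ih _).trans
      (Real.add_rpow_le_rpow_add (hf i) (Finset.sum_nonneg fun j _ => hf j) hη)

lemma deg_nonneg {N : ℕ} (H : SimpleGraph (Fin N)) (v : Fin N) : 0 ≤ deg H v := Nat.cast_nonneg _

/-- The component of a good pair is a tree, and its degrees are controlled by its size. -/
lemma IsGoodPair.component {N k r ℓ : ℕ} {bx b : ℝ} {H : SimpleGraph (Fin N)} {x y : Fin N}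
    (h : IsGoodPair k r ℓ bx b H x y) :
    (H.connectedComponentMk x).toSimpleGraph.IsTree ∧ deg H x ≤ 2 * ℓ ∧ deg H y ≤ 2 * ℓ ∧
      ∀ η : ℝ, 1 ≤ η → deg H x ^ η ≤ degreeMoment H η x ∧ degreeMoment H η x ≤ (2 * ℓ : ℝ) ^ η := by
  obtain ⟨hxy, -, -, ⟨L, D, hD, hcard⟩, -, -⟩ := h
  obtain ⟨htree, hsupp, hsum⟩ := hD.isTree_component hxy
  have hsumℓ : ∑ v ∈ D, deg H v ≤ 2 * ℓ := by
    have : (D.card : ℝ) ≤ ℓ := by exact_mod_cast hcard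
    linarith
  have hdeg : ∀ v ∈ D, deg H v ≤ 2 * ℓ := fun v hv =>
    (Finset.single_le_sum (fun v _ => deg_nonneg H v) hv).trans hsumℓ
  have hmom : ∀ η, degreeMoment H η x = ∑ v ∈ D, deg H v ^ η := fun η => by
    unfold degreeMoment
    congr 1
    ext v
    simp only [Finset.mem_filter, Finset.mem_univ, true_and, hsupp]
  refine ⟨htree, hdeg x (hD.subset_left (by simp)), hdeg y (hD.subset_left (by simp)),
    fun η hη => ?_⟩
  rw [hmom]
  exact ⟨Finset.single_le_sum (f := fun v => deg H v ^ η)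
      (fun v _ => Real.rpow_nonneg (deg_nonneg H v) η) (hD.subset_left (by simp)),
    (sum_rpow_le_rpow_sum D (deg_nonneg H) hη).trans (Real.rpow_le_rpow
      (Finset.sum_nonneg fun v _ => deg_nonneg H v) hsumℓ (by linarith))⟩

/-! ### Asymptotics -/

section Asymptotics

variable {β γ : ℝ}

lemma eventually_scale (hγ : 0 < γ) (hγ2 : 2 * γ < 1) (β : ℝ) : ∀ᶠ n : ℝ in atTop,
    4 ≤ n ∧ 6 ≤ Real.log n ∧ 1 ≤ n ^ ((1 - 2 * γ) / (2 - 2 * γ)) ∧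
      2 * (n ^ ((1 - 2 * γ) / (2 - 2 * γ))) ^ 2 * Real.log n ≤ n ∧
      β * n ^ (2 * γ - 1) ≤ 1 / 2 := by
  have h1 : 0 < 2 - 2 * γ := by linarith
  have h2 : 0 < γ / (1 - γ) := div_pos hγ (by linarith)
  have hlog := (isLittleO_log_rpow_atTop h2).bound (by norm_num : (0 : ℝ) < 1 / 2)
  have hpow : Tendsto (fun n : ℝ => β * n ^ (2 * γ - 1)) atTop (𝓝 0) := by
    have h := (tendsto_rpow_neg_atTop (by linarith : 0 < 1 - 2 * γ)).const_mul β
    simpa [neg_sub] using h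
  filter_upwards [eventually_ge_atTop 4, Real.tendsto_log_atTop.eventually_ge_atTop 6, hlog,
    hpow.eventually_le_const (by norm_num : (0 : ℝ) < 1 / 2)] with n hn hl hlog hpow
  have hn0 : 0 < n := by linarith
  refine ⟨hn, hl, Real.one_le_rpow (by linarith) (div_nonneg (by linarith) h1.le), ?_, hpow⟩
  rw [Real.norm_of_nonneg (by linarith), Real.norm_of_nonneg (Real.rpow_nonneg hn0.le _)] at hlog
  have hM : (n ^ ((1 - 2 * γ) / (2 - 2 * γ))) ^ 2 * n ^ (γ / (1 - γ)) = n := by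
    rw [← Real.rpow_natCast, ← Real.rpow_mul hn0.le, ← Real.rpow_add hn0]
    have : (1 - 2 * γ) / (2 - 2 * γ) * ((2 : ℕ) : ℝ) + γ / (1 - γ) = 1 := by
      have : 1 - γ ≠ 0 := by linarith
      rw [show 2 - 2 * γ = 2 * (1 - γ) by ring]
      push_cast
      field_simp
      ring
    rw [this, Real.rpow_one]
  calc 2 * (n ^ ((1 - 2 * γ) / (2 - 2 * γ))) ^ 2 * Real.log n
      ≤ 2 * (n ^ ((1 - 2 * γ) / (2 - 2 * γ))) ^ 2 * (1 / 2 * n ^ (γ / (1 - γ))) := by gcongr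
    _ = (n ^ ((1 - 2 * γ) / (2 - 2 * γ))) ^ 2 * n ^ (γ / (1 - γ)) := by ring
    _ = n := hM

lemma tendsto_failure (hβ : 0 < β) (hγ : 0 < γ) (hγ2 : 2 * γ < 1) (C : ℝ) :
    Tendsto (fun n : ℝ => Real.exp (-(β * (((⌊Real.log n / 2⌋₊ : ℝ) - 2) *
        (2 * (⌊Real.log n / 2⌋₊ : ℝ)) ^ (-γ)))) +
      C * ((⌊Real.log n / 2⌋₊ : ℝ) * (⌈n ^ ((1 - 2 * γ) / (2 - 2 * γ))⌉₊ : ℝ) ^ (-γ)))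
      atTop (𝓝 0) := by
  have hr : Tendsto (fun n : ℝ => ⌊Real.log n / 2⌋₊) atTop atTop :=
    tendsto_nat_floor_atTop.comp (Real.tendsto_log_atTop.atTop_div_const (by norm_num))
  have h1 : Tendsto (fun r : ℕ => ((r : ℝ) - 2) * (2 * (r : ℝ)) ^ (-γ)) atTop atTop := by
    have h2 : Tendsto (fun r : ℕ => (2 : ℝ) ^ (-γ) / 2 * (r : ℝ) ^ (1 - γ)) atTop atTop :=
      ((tendsto_rpow_atTop (by linarith : 0 < 1 - γ)).comp
        tendsto_natCast_atTop_atTop).const_mul_atTop (by positivity)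
    refine tendsto_atTop_mono' _ ?_ h2
    filter_upwards [eventually_ge_atTop 4] with r hr
    have hr4 : (4 : ℝ) ≤ r := by exact_mod_cast hr
    have hr0 : (0 : ℝ) < r := by linarith
    rw [Real.mul_rpow (by norm_num) hr0.le, sub_eq_add_neg 1 γ, Real.rpow_one_add' hr0.le
      (by linarith)]
    have : 0 < (2 : ℝ) ^ (-γ) * (r : ℝ) ^ (-γ) := by positivity
    nlinarith
  have hexp : Tendsto (fun n : ℝ => Real.exp (-(β * (((⌊Real.log n / 2⌋₊ : ℝ) - 2) *
        (2 * (⌊Real.log n / 2⌋₊ : ℝ)) ^ (-γ))))) atTop (𝓝 0) :=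
    Real.tendsto_exp_neg_atTop_nhds_zero.comp ((h1.comp hr).const_mul_atTop hβ)
  set e := (1 - 2 * γ) / (2 - 2 * γ) with he
  have he0 : 0 < e := div_pos (by linarith) (by linarith)
  have hlog : Tendsto (fun n : ℝ => Real.log n / n ^ (e * γ)) atTop (𝓝 0) :=
    (isLittleO_log_rpow_atTop (mul_pos he0 hγ)).tendsto_div_nhds_zero
  have hsq : Tendsto (fun n : ℝ => (⌊Real.log n / 2⌋₊ : ℝ) * (⌈n ^ e⌉₊ : ℝ) ^ (-γ))
      atTop (𝓝 0) := by
    refine squeeze_zero' (Eventually.of_forall fun n => by positivity) ?_ hlog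
    filter_upwards [eventually_ge_atTop 1] with n hn
    have hn0 : 0 < n := by linarith
    have hl : 0 ≤ Real.log n := Real.log_nonneg hn
    have hM : 0 < n ^ e := by positivity
    have h3 : (⌊Real.log n / 2⌋₊ : ℝ) ≤ Real.log n :=
      (Nat.floor_le (by positivity)).trans (by linarith)
    have h4 : (⌈n ^ e⌉₊ : ℝ) ^ (-γ) ≤ (n ^ e) ^ (-γ) :=
      Real.rpow_le_rpow_of_nonpos hM (Nat.le_ceil _) (by linarith)
    calc _ ≤ Real.log n * (n ^ e) ^ (-γ) := by gcongr
      _ = Real.log n / n ^ (e * γ) := by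
        rw [← Real.rpow_mul hn0.le, mul_neg, Real.rpow_neg hn0.le]; rfl
  simpa using hexp.add (hsq.const_mul C)

/-- The scale `k = ⌈n^((1-2γ)/(2-2γ))⌉` solves `n^(2γ-1) k^(2-2γ) ≈ 1`. -/
lemma rpow_mul_ceil_rpow_bounds (hγ : 0 < γ) (hγ2 : 2 * γ < 1) {n : ℝ} (hn : 0 < n)
    (hM : 1 ≤ n ^ ((1 - 2 * γ) / (2 - 2 * γ))) :
    1 ≤ n ^ (2 * γ - 1) * (⌈n ^ ((1 - 2 * γ) / (2 - 2 * γ))⌉₊ : ℝ) ^ (2 - 2 * γ) ∧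
      n ^ (2 * γ - 1) * (⌈n ^ ((1 - 2 * γ) / (2 - 2 * γ))⌉₊ : ℝ) ^ (2 - 2 * γ) ≤ 4 := by
  set M := n ^ ((1 - 2 * γ) / (2 - 2 * γ)) with hMdef
  have h2γ : 0 < 2 - 2 * γ := by linarith
  have hM0 : 0 < M := by linarith
  have hMpow : n ^ (2 * γ - 1) * M ^ (2 - 2 * γ) = 1 := by
    rw [hMdef, ← Real.rpow_mul hn.le, div_mul_cancel₀ _ h2γ.ne', ← Real.rpow_add hn]
    simp
  have h1 : M ≤ ⌈M⌉₊ := Nat.le_ceil _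
  have h2 : (⌈M⌉₊ : ℝ) ≤ 2 * M := by linarith [Nat.ceil_lt_add_one hM0.le]
  constructor
  · refine hMpow.symm.le.trans ?_
    gcongr
  · calc n ^ (2 * γ - 1) * (⌈M⌉₊ : ℝ) ^ (2 - 2 * γ)
        ≤ n ^ (2 * γ - 1) * (2 * M) ^ (2 - 2 * γ) := by gcongr
      _ = 2 ^ (2 - 2 * γ) * (n ^ (2 * γ - 1) * M ^ (2 - 2 * γ)) := by
          rw [Real.mul_rpow (by norm_num) hM0.le]; ring
      _ ≤ 2 ^ (2 : ℝ) * 1 := by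
          rw [hMpow]
          gcongr
          · norm_num
          · linarith
      _ = 4 := by norm_num

/-- The properties of a good pair at the scale `k = ⌈N^((1-2γ)/(2-2γ))⌉` and `r = ⌊log N / 2⌋`. -/
lemma IsGoodPair.bounds (hβ : 0 < β) (hγ : 0 < γ) (hγ2 : 2 * γ < 1) {C : ℝ} (hC : 0 < C)
    {N : ℕ+} (hM : 1 ≤ (N : ℝ) ^ ((1 - 2 * γ) / (2 - 2 * γ))) (hlog : 6 ≤ Real.log (N : ℝ))
    {k r ℓ : ℕ} (hk : k = ⌈(N : ℝ) ^ ((1 - 2 * γ) / (2 - 2 * γ))⌉₊)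
    (hr : r = ⌊Real.log (N : ℝ) / 2⌋₊) (hℓ : ℓ = ⌈C * ((N : ℝ) / k) ^ γ⌉₊)
    {H : SimpleGraph (Fin N)} {x y : Fin N}
    (h : IsGoodPair k r ℓ (β / 8 * ((N : ℝ) / (2 * k)) ^ γ)
      (β / 8 * ((N : ℝ) / (k * r)) ^ γ) H x y) :
    label x ≤ bigBound γ N ∧ label y ≤ bigBound γ N ∧
      (2 * ℓ : ℝ) ≤ 2 * (C + 1) * (N : ℝ) ^ (γ / (2 - 2 * γ)) ∧
      β / 8 * 4 ^ (-γ) * (N : ℝ) ^ (γ / (2 - 2 * γ)) ≤ deg H x ∧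
      β / 8 * 4 ^ (-γ) * (N : ℝ) ^ (γ / (2 - 2 * γ)) ≤ deg H y * Real.log (N : ℝ) ^ γ := by
  set n : ℝ := (N : ℝ) with hn
  have hn0 : 0 < n := by rw [hn]; exact_mod_cast N.pos
  set M := n ^ ((1 - 2 * γ) / (2 - 2 * γ)) with hMdef
  set D := n ^ (γ / (2 - 2 * γ)) with hD
  have h2γ : 0 < 2 - 2 * γ := by linarith
  have h1γ : 1 - γ ≠ 0 := by linarith
  have he : 1 - (1 - 2 * γ) / (2 - 2 * γ) = 1 / (2 - 2 * γ) := by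
    rw [eq_div_iff h2γ.ne', sub_mul, div_mul_cancel₀ _ h2γ.ne']
    ring
  have hM0 : 0 < M := by linarith
  have hn1 : 1 ≤ n := by rw [hn]; exact Nat.one_le_cast.2 N.pos
  have hD1 : 1 ≤ D := Real.one_le_rpow hn1 (by positivity)
  have hl0 : 0 < Real.log n := by linarith
  have hnM : (n / M) ^ γ = D := by
    rw [hMdef, ← Real.rpow_one_sub' hn0.le (by rw [he]; positivity), ← Real.rpow_mul hn0.le, hD,
      he, one_div_mul_eq_div]
  have hMk : M ≤ k := by rw [hk]; exact Nat.le_ceil _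
  have hkM : (k : ℝ) ≤ 2 * M := by
    rw [hk]; linarith [(Nat.ceil_lt_add_one hM0.le).le]
  have hk0 : (0 : ℝ) < k := by linarith
  have hrl : (r : ℝ) ≤ Real.log n / 2 := by rw [hr]; exact Nat.floor_le (by positivity)
  have hkr : (k : ℝ) * r ≤ M * Real.log n := by
    calc (k : ℝ) * r ≤ 2 * M * (Real.log n / 2) := by gcongr
      _ = M * Real.log n := by ring
  obtain ⟨-, ⟨-, hx⟩, ⟨hy2, hy⟩, -, hdx, hdy⟩ := h
  have hly : label y ≤ k * r := by
    unfold label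
    exact_mod_cast (by omega : (y : ℕ) + 1 ≤ k * r)
  have hlx : label x ≤ k * r := by
    unfold label
    exact_mod_cast (by omega : (x : ℕ) + 1 ≤ k * r)
  have hkr0 : (0 : ℝ) < k * r := (label_pos y).trans_le hly
  refine ⟨hlx.trans hkr, hly.trans hkr, ?_, ?_, ?_⟩
  · have h1 : C * (n / k) ^ γ ≤ C * D := by rw [← hnM]; gcongr
    have h2 : (ℓ : ℝ) ≤ C * (n / k) ^ γ + 1 := by
      rw [hℓ]; exact (Nat.ceil_lt_add_one (by positivity)).le
    linarith
  · refine le_trans ?_ hdx.le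
    calc β / 8 * 4 ^ (-γ) * D = β / 8 * (n / (2 * (2 * M))) ^ γ := by
          rw [← hnM, mul_assoc, Real.rpow_neg (by norm_num), ← Real.inv_rpow (by norm_num),
            ← Real.mul_rpow (by norm_num) (by positivity)]
          congr 2
          field_simp
          norm_num
      _ ≤ _ := by gcongr
  · have h4 : (4 : ℝ) ^ (-γ) ≤ 1 := Real.rpow_le_one_of_one_le_of_nonpos (by norm_num) (by linarith)
    have hlγ : 0 < Real.log n ^ γ := by positivity
    calc β / 8 * 4 ^ (-γ) * D ≤ β / 8 * 1 * D := by gcongr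
      _ = β / 8 * (n / (M * Real.log n)) ^ γ * Real.log n ^ γ := by
          rw [← div_div, Real.div_rpow (by positivity) hl0.le, hnM]
          field_simp
      _ ≤ β / 8 * (n / (k * r)) ^ γ * Real.log n ^ γ := by gcongr
      _ ≤ deg H y * Real.log n ^ γ := by gcongr

end Asymptotics

end DoubleStar

theorem mainTheorem9 (β γ : ℝ) (hβ : 0 < β) (hγ : 0 < γ) (hsub : β + 2 * γ < 1)
    {Ω : ℕ+ → Type*} [∀ N, MeasurableSpace (Ω N)]
    (P : ∀ N, Measure (Ω N)) [∀ N, IsProbabilityMeasure (P N)]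
    (G : ∀ N : ℕ+, Ω N → SimpleGraph (Fin N))
    (hG : DoubleStar.IsRandomGraphModel β γ P G) :
    ∃ x y : ∀ N : ℕ+, SimpleGraph (Fin N) → Fin N,
      DoubleStar.WHP P (fun N ω =>
        (G N ω).Adj (x N (G N ω)) (y N (G N ω)) ∧
        DoubleStar.label (x N (G N ω)) ≤ DoubleStar.bigBound γ N ∧
        DoubleStar.label (y N (G N ω)) ≤ DoubleStar.bigBound γ N ∧
        ((G N ω).connectedComponentMk (x N (G N ω))).toSimpleGraph.IsTree) ∧
      DoubleStar.ThetaLog P (fun N ω => DoubleStar.deg (G N ω) (x N (G N ω)))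
        (fun N _ => (N : ℝ) ^ (γ / (2 - 2 * γ))) ∧
      DoubleStar.ThetaLog P (fun N ω => DoubleStar.deg (G N ω) (y N (G N ω)))
        (fun N _ => (N : ℝ) ^ (γ / (2 - 2 * γ))) ∧
      ∀ η : ℝ, 1 ≤ η →
        DoubleStar.Theta P
          (fun N ω => DoubleStar.degreeMoment (G N ω) η (x N (G N ω)))
          (fun N _ => (N : ℝ) ^ (γ * η / (2 - 2 * γ))) := by
  classical
  have hγ2 : 2 * γ < 1 := by linarith
  obtain ⟨q, -, hq, hmeas, hprob, hind, hclose⟩ := hG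
  obtain ⟨C, C₁, hC, hC₁, hgood⟩ := DoubleStar.exists_real_not_isGoodPair_le hβ hγ hsub
  set k : ℕ+ → ℕ := fun N => ⌈(N : ℝ) ^ ((1 - 2 * γ) / (2 - 2 * γ))⌉₊ with hk
  set r : ℕ+ → ℕ := fun N => ⌊Real.log (N : ℝ) / 2⌋₊ with hr
  set ℓ : ℕ+ → ℕ := fun N => ⌈C * ((N : ℝ) / k N) ^ γ⌉₊ with hℓ
  set Good : ∀ N : ℕ+, SimpleGraph (Fin N) → Fin N → Fin N → Prop := fun N H x y =>
    DoubleStar.IsGoodPair (k N) (r N) (ℓ N) (β / 8 * ((N : ℝ) / (2 * k N)) ^ γ)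
      (β / 8 * ((N : ℝ) / (k N * r N)) ^ γ) H x y with hGood
  have hcast : Tendsto (fun N : ℕ+ => (N : ℝ)) atTop atTop :=
    tendsto_natCast_atTop_atTop.comp tendsto_PNat_val_atTop_atTop
  have hscale := hcast.eventually (DoubleStar.eventually_scale hγ hγ2 β)
  -- A good pair exists with high probability.
  have hE : Tendsto (fun N => (P N).real {ω | ¬ ∃ x y, Good N (G N ω) x y}) atTop (𝓝 0) := by
    have hfail := ((DoubleStar.tendsto_failure hβ hγ hγ2 C₁).comp hcast).const_mul (Real.exp 2)
    rw [mul_zero] at hfail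
    have hsq : Tendsto (fun N => (P N).real {ω | ¬ ∃ x y, Good N (G N ω) x y} ^ 2) atTop (𝓝 0) := by
      refine squeeze_zero' (Eventually.of_forall fun N => sq_nonneg _) ?_ hfail
      filter_upwards [hscale, hclose.eventually_le_const one_pos] with N hN hcl
      obtain ⟨hn4, hlog, hM, hMlog, ha⟩ := hN
      have hn0 : (0 : ℝ) < N := by linarith
      refine DoubleStar.sq_real_le_of_chungLu hβ hγ ha
        ⟨fun e => hmeas N e.1.1 e.1.2, hind N⟩ (q := q N)
        (fun i j hij => ?_) hcl (fun H => ¬ ∃ x y, Good N H x y) ?_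
      · rw [measureReal_def, hprob N i j hij, ENNReal.toReal_ofReal (hq N i j).1.le]
      · intro Ω' _ ν _ G' hG' hp
        have hbd := DoubleStar.rpow_mul_ceil_rpow_bounds hγ hγ2 hn0 hM
        refine hgood N (k N) (r N) (ℓ N) (by exact_mod_cast hn4)
          (Nat.one_le_ceil_iff.2 (by linarith)) (Nat.le_floor (by push_cast; linarith)) ?_
          hbd.1 hbd.2 (Nat.le_ceil _) ν G' hG' hp
        have hk2 : (k N : ℝ) ≤ 2 * (N : ℝ) ^ ((1 - 2 * γ) / (2 - 2 * γ)) := by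
          linarith [Nat.ceil_lt_add_one (zero_le_one.trans hM)]
        have hr2 : (r N : ℝ) ≤ Real.log (N : ℝ) / 2 := Nat.floor_le (by linarith)
        have : (k N : ℝ) ^ 2 * r N ≤ (N : ℝ) := by
          calc (k N : ℝ) ^ 2 * r N
              ≤ (2 * (N : ℝ) ^ ((1 - 2 * γ) / (2 - 2 * γ))) ^ 2 * (Real.log (N : ℝ) / 2) := by
                gcongr
            _ = 2 * ((N : ℝ) ^ ((1 - 2 * γ) / (2 - 2 * γ))) ^ 2 * Real.log (N : ℝ) := by ring
            _ ≤ N := hMlog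
        exact_mod_cast this
    have := hsq.sqrt
    simpa [Real.sqrt_sq measureReal_nonneg] using this
  -- The vertices `x` and `y` form a good pair whenever there is one.
  set pick : ∀ N : ℕ+, SimpleGraph (Fin N) → Fin N × Fin N := fun N H =>
    if h : ∃ z : Fin N × Fin N, Good N H z.1 z.2 then h.choose else (⟨0, N.pos⟩, ⟨0, N.pos⟩)
    with hpick_def
  have hpick : ∀ N H, (∃ x y, Good N H x y) → Good N H (pick N H).1 (pick N H).2 := by
    rintro N H ⟨x, y, hxy⟩
    have h : ∃ z : Fin N × Fin N, Good N H z.1 z.2 := ⟨(x, y), hxy⟩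
    simp only [hpick_def, dif_pos h]
    exact h.choose_spec
  have whp : ∀ {A : ∀ N : ℕ+, SimpleGraph (Fin N) → Fin N → Fin N → Prop},
      (∀ᶠ N in atTop, ∀ H x y, Good N H x y → A N H x y) →
      DoubleStar.WHP P fun N ω => A N (G N ω) (pick N (G N ω)).1 (pick N (G N ω)).2 := by
    intro A hA
    refine DoubleStar.WHP.of_eventually_imp hE ?_
    filter_upwards [hA] with N hN ω hω
    exact hN _ _ _ (hpick N _ hω)
  set c := β / 8 * 4 ^ (-γ) with hc
  have hc0 : 0 < c := by positivity
  set Z := 2 * (C + 1) with hZ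
  have hZ0 : 0 < Z := by positivity
  set D : ℕ+ → ℝ := fun N => (N : ℝ) ^ (γ / (2 - 2 * γ)) with hD
  have hD0 : ∀ N, 0 < D N := fun N => Real.rpow_pos_of_pos (by exact_mod_cast N.pos) _
  have hDη : ∀ (N : ℕ+) (η : ℝ), (N : ℝ) ^ (γ * η / (2 - 2 * γ)) = D N ^ η := fun N η => by
    rw [hD, ← Real.rpow_mul (Nat.cast_nonneg _)]; congr 1; ring
  have hbounds : ∀ᶠ N in atTop, ∀ H x y, Good N H x y →
      DoubleStar.label x ≤ DoubleStar.bigBound γ N ∧ DoubleStar.label y ≤ DoubleStar.bigBound γ N ∧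
      (2 * ℓ N : ℝ) ≤ Z * D N ∧ c * D N ≤ DoubleStar.deg H x ∧
      c * D N ≤ DoubleStar.deg H y * Real.log (N : ℝ) ^ γ := by
    filter_upwards [hscale] with N hN H x y h
    exact h.bounds hβ hγ hγ2 hC hN.2.2.1 hN.2.1 rfl rfl rfl
  have hloglarge : ∀ b : ℝ, ∀ᶠ N : ℕ+ in atTop, b ≤ Real.log (N : ℝ) := fun b =>
    (Real.tendsto_log_atTop.comp hcast).eventually_ge_atTop b
  -- Powers of the logarithm absorb constants.
  have habsorb : ∀ b : ℝ, ∀ᶠ N : ℕ+ in atTop, b * Real.log (N : ℝ) ^ γ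
      ≤ Real.log (N : ℝ) ^ (γ + 1) ∧ 1 ≤ Real.log (N : ℝ) ^ γ := by
    intro b
    filter_upwards [hloglarge b, hloglarge 1] with N hb h1
    have h0 : 0 < Real.log (N : ℝ) := by linarith
    rw [Real.rpow_add_one h0.ne', mul_comm]
    exact ⟨by gcongr, Real.one_le_rpow h1 hγ.le⟩
  have hγ1 : 0 < γ + 1 := by linarith
  refine ⟨fun N H => (pick N H).1, fun N H => (pick N H).2,
    whp (A := fun N H x y => H.Adj x y ∧ DoubleStar.label x ≤ DoubleStar.bigBound γ N ∧
      DoubleStar.label y ≤ DoubleStar.bigBound γ N ∧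
      (H.connectedComponentMk x).toSimpleGraph.IsTree) ?_,
    ⟨⟨γ + 1, hγ1, whp (A := fun N H x y =>
        DoubleStar.deg H x ≤ D N * Real.log (N : ℝ) ^ (γ + 1)) ?_⟩,
      ⟨γ + 1, hγ1, whp (A := fun N H x y =>
        D N ≤ DoubleStar.deg H x * Real.log (N : ℝ) ^ (γ + 1)) ?_⟩⟩,
    ⟨⟨γ + 1, hγ1, whp (A := fun N H x y =>
        DoubleStar.deg H y ≤ D N * Real.log (N : ℝ) ^ (γ + 1)) ?_⟩,
      ⟨γ + 1, hγ1, whp (A := fun N H x y =>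
        D N ≤ DoubleStar.deg H y * Real.log (N : ℝ) ^ (γ + 1)) ?_⟩⟩,
    fun η hη => ⟨⟨Z ^ η, by positivity, whp (A := fun N H x y =>
        DoubleStar.degreeMoment H η x ≤ Z ^ η * (N : ℝ) ^ (γ * η / (2 - 2 * γ))) ?_⟩,
      ⟨(c ^ η)⁻¹, by positivity, whp (A := fun N H x y =>
        (N : ℝ) ^ (γ * η / (2 - 2 * γ)) ≤ (c ^ η)⁻¹ * DoubleStar.degreeMoment H η x) ?_⟩⟩⟩
  · filter_upwards [hbounds] with N hN H x y h
    exact ⟨h.1, (hN H x y h).1, (hN H x y h).2.1, h.component.1⟩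
  · filter_upwards [hbounds, habsorb Z] with N hN hlog H x y h
    have h1 : Z ≤ Real.log (N : ℝ) ^ (γ + 1) := (le_mul_of_one_le_right hZ0.le hlog.2).trans hlog.1
    calc DoubleStar.deg H x ≤ Z * D N := h.component.2.1.trans (hN H x y h).2.2.1
      _ ≤ D N * Real.log (N : ℝ) ^ (γ + 1) := by
        rw [mul_comm]; exact mul_le_mul_of_nonneg_left h1 (hD0 N).le
  · filter_upwards [hbounds, habsorb c⁻¹] with N hN hlog H x y h
    have h1 : c⁻¹ ≤ Real.log (N : ℝ) ^ (γ + 1) :=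
      (le_mul_of_one_le_right (inv_pos.2 hc0).le hlog.2).trans hlog.1
    calc D N = c * D N * c⁻¹ := by field_simp
      _ ≤ DoubleStar.deg H x * Real.log (N : ℝ) ^ (γ + 1) :=
        mul_le_mul (hN H x y h).2.2.2.1 h1 (inv_pos.2 hc0).le (DoubleStar.deg_nonneg H x)
  · filter_upwards [hbounds, habsorb Z] with N hN hlog H x y h
    have h1 : Z ≤ Real.log (N : ℝ) ^ (γ + 1) := (le_mul_of_one_le_right hZ0.le hlog.2).trans hlog.1
    calc DoubleStar.deg H y ≤ Z * D N := h.component.2.2.1.trans (hN H x y h).2.2.1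
      _ ≤ D N * Real.log (N : ℝ) ^ (γ + 1) := by
        rw [mul_comm]; exact mul_le_mul_of_nonneg_left h1 (hD0 N).le
  · filter_upwards [hbounds, habsorb c⁻¹] with N hN hlog H x y h
    calc D N = c⁻¹ * (c * D N) := by field_simp
      _ ≤ c⁻¹ * (DoubleStar.deg H y * Real.log (N : ℝ) ^ γ) :=
        mul_le_mul_of_nonneg_left (hN H x y h).2.2.2.2 (inv_pos.2 hc0).le
      _ = DoubleStar.deg H y * (c⁻¹ * Real.log (N : ℝ) ^ γ) := by ring
      _ ≤ DoubleStar.deg H y * Real.log (N : ℝ) ^ (γ + 1) :=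
        mul_le_mul_of_nonneg_left hlog.1 (DoubleStar.deg_nonneg H y)
  · filter_upwards [hbounds] with N hN H x y h
    rw [hDη, ← Real.mul_rpow hZ0.le (hD0 N).le]
    exact (h.component.2.2.2 η hη).2.trans
      (Real.rpow_le_rpow (by positivity) (hN H x y h).2.2.1 (by linarith))
  · filter_upwards [hbounds] with N hN H x y h
    rw [hDη, inv_mul_eq_div, le_div_iff₀ (by positivity), mul_comm,
      ← Real.mul_rpow hc0.le (hD0 N).le]
    have hcD : 0 ≤ c * D N := mul_nonneg hc0.le (hD0 N).le
    exact (Real.rpow_le_rpow hcD (hN H x y h).2.2.2.1 (by linarith)).trans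
      (h.component.2.2.2 η hη).1
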